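/- Let $-1<\alpha_1<\beta_1<\alpha_2<\beta_2<\dots<\alpha_g<\beta_g<1$ ($g\ge 0$), let $E=[-1,1]\setminus\bigcup_{i=1}^g(\alpha_i,\beta_i)$ and $$w(x)=\frac1\pi\sqrt{\frac{\prod_{i=1}^g(x-\alpha_i)}{(1-x^2)\prod_{i=1}^g(x-\beta_i)}}\qquad(x\in E).$$ Let $P_0,P_1,P_2,\dots$ be the monic polynomials orthogonal on $E$ with respect to $w$, let $$Q_n(x)=\int_E\frac{P_n(x)-P_n(t)}{x-t}\,w(t)\,dt$$ be the polynomials of the second kind, and let $a_n,b_n$ be the coefficients of the recurrence $xP_n=P_{n+1}+b_{n+1}P_n+a_nP_{n-1}$ $(n\ge1)$, $xP_0=P_1+b_1P_0$. Suppose that the recurrence coefficients are periodic with period $\mathfrak K$, that is, $b_{n+\mathfrak K}=b_n$ for $n\ge1$ and $a_{n+\mathfrak K}=a_n$ for $n\ge2$. Let $n\ge1$ and $1\le j<\mathfrak K$, let $A$ be the set of the zeros of $P_{n\mathfrak K}$ and of $P_j$, and let $$B=\bigl(\{-1,1,\beta_1,\dots,\beta_g\}\cup\{y:Q_j(y)=0\}\cup\{y:Q_{n\mathfrak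 K}(y)=0\}\bigr)\setminus\{\alpha_1,\dots,\alpha_g\}.$$ Then: 1. Strictly between any zero of $P_j$ and any larger element of $B$ there lies at least one zero of $P_{n\mathfrak K+j}$. 2. Strictly between any zero of $Q_j$ and any larger element of $A$ there lies at least one zero of $P_{n\mathfrak K+j}$. 3. If $P_j$ vanishes at a point of $B$, then $P_{n\mathfrak K+j}$ vanishes at the same point. -/

import Mathlib

open Polynomial MeasureTheory

namespace GenChebyshev

noncomputable section

/-- The gaps `(α i, β i)`, `i = 0, …, g - 1`, are nonempty open intervals inside `(-1, 1)`, listed from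
left to right and separated by nondegenerate closed intervals:
`-1 < α 0 < β 0 < α 1 < β 1 < … < α (g - 1) < β (g - 1) < 1`. -/
def IsGapSystem {g : ℕ} (α β : Fin g → ℝ) : Prop :=
  (∀ i, -1 < α i ∧ α i < β i ∧ β i < 1) ∧ ∀ i k, i < k → β i < α k

/-- The set `E = [-1, α 0] ∪ [β 0, α 1] ∪ … ∪ [β (g - 1), 1]`, that is, `[-1, 1]` without the open gaps. -/
def E {g : ℕ} (α β : Fin g → ℝ) : Set ℝ :=
  Set.Icc (-1) 1 \ ⋃ i, Set.Ioo (α i) (β i)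

/-- The weight `w(x) = (1/π) √(∏ (x - α i) / ((1 - x²) ∏ (x - β i)))`. The radicand is nonnegative on `E`
away from the finitely many endpoints where the denominator vanishes. -/
def w {g : ℕ} (α β : Fin g → ℝ) (x : ℝ) : ℝ :=
  1 / Real.pi * Real.sqrt ((∏ i, (x - α i)) / ((1 - x ^ 2) * ∏ i, (x - β i)))

/-- The inner product `∫_E p(x) q(x) w(x) dx` of two real polynomials. -/
def ip {g : ℕ} (α β : Fin g → ℝ) (p q : ℝ[X]) : ℝ :=
  ∫ x in E α β, p.eval x * q.eval x * w α β x

/-- The monic orthogonal polynomials with respect to `w` on `E` (generalized Chebyshev polynomials of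
the first kind), obtained from `1, X, X², …` by the Gram-Schmidt process without normalization. -/
def P {g : ℕ} (α β : Fin g → ℝ) (n : ℕ) : ℝ[X] :=
  X ^ n - ∑ k : Fin n,
    C (ip α β (X ^ n) (P α β k) / ip α β (P α β k) (P α β k)) * P α β k
termination_by n
decreasing_by all_goals exact k.2

/-- The polynomials of the second kind `Q_n(x) = ∫_E (P_n(x) - P_n(t)) / (x - t) w(t) dt`, as functions.
The single point `t = x` is a null set. -/
def Q {g : ℕ} (α β : Fin g → ℝ) (n : ℕ) (x : ℝ) : ℝ :=
  ∫ t in E α β, ((P α β n).eval x - (P α β n).eval t) / (x - t) * w α β t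

/-- `a` and `b` are the coefficients of the three term recurrence
`x P_n = P_{n+1} + b_{n+1} P_n + a_n P_{n-1}` (for `n = 0` without the last term).
The values `a 0` and `b 0` play no role. -/
def IsRecurrence {g : ℕ} (α β : Fin g → ℝ) (a b : ℕ → ℝ) : Prop :=
  X * P α β 0 = P α β 1 + C (b 1) * P α β 0 ∧
  ∀ n : ℕ, 1 ≤ n →
    X * P α β n = P α β (n + 1) + C (b (n + 1)) * P α β n + C (a n) * P α β (n - 1)

/-- The recurrence coefficients are periodic with (not necessarily least) period `K`:
`b_{n+K} = b_n` for `n ≥ 1` and `a_{n+K} = a_n` for `n ≥ 2`. -/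
def HasPeriod {g : ℕ} (α β : Fin g → ℝ) (K : ℕ) : Prop :=
  ∃ a b : ℕ → ℝ, IsRecurrence α β a b ∧
    (∀ n, 1 ≤ n → b (n + K) = b n) ∧ ∀ n, 2 ≤ n → a (n + K) = a n

/-- The real zeros of `P_n`. -/
def zerosP {g : ℕ} (α β : Fin g → ℝ) (n : ℕ) : Set ℝ := {x | (P α β n).eval x = 0}

/-- The real zeros of `Q_n`. -/
def zerosQ {g : ℕ} (α β : Fin g → ℝ) (n : ℕ) : Set ℝ := {x | Q α β n x = 0}

/-- The set `A`: the zeros of `P_{nK}` and of `P_j`. -/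
def setA {g : ℕ} (α β : Fin g → ℝ) (K n j : ℕ) : Set ℝ :=
  zerosP α β (n * K) ∪ zerosP α β j

/-- The set `B`: the points `±1` and `β i`, the zeros of `Q_j` and of `Q_{nK}`, without the points
`α i`. -/
def setB {g : ℕ} (α β : Fin g → ℝ) (K n j : ℕ) : Set ℝ :=
  ({-1, 1} ∪ Set.range β ∪ zerosQ α β j ∪ zerosQ α β (n * K)) \ Set.range α

end

end GenChebyshev

/-!
The Stieltjes transform of `w` is `f = √(N / D)` with `N = ∏ (x - α i)` and
`D = (x² - 1) ∏ (x - β i)`: under `x = (v + v⁻¹) / 2` the root of `∏ (x - α i) / (x - β i)` becomes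
a holomorphic function on the unit disc, because the ratio has positive residues, and its Poisson
integral is the Stieltjes integral. Periodicity with period `M = n K` makes `f` a root of a
quadratic equation with polynomial coefficients, and as `√(N / D)` is irrational the linear term
vanishes. This gives `G N = Q_M D` for `G = 2 P_{M+1} - P_1 P_M`, and the addition formula
`2 P_{M+j} = P_M P_j + G Q_j`.

The Wronskians of the pairs `(Q_j, P_j)` and `(P_M, G)` are positive everywhere, by the confluent
Christoffel–Darboux formula; that of `G` and `P_j (P_j P_M - Q_j G)` is negative away from the zeros
of `G`, because `P_n P_M - Q_n G` is constant for `n = M` and solves the recurrence backwards from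
there. These three monotonicity facts fix the signs of `P_M P_j + G Q_j` at both ends of an interval
from a zero of `P_j` to the next zero of `G Q_j`. The pair `(Q_j, -P_j)` is treated in the same way.
-/

open Filter Topology Set

namespace GenChebyshev

section PartialFractions

variable {F : Type*} [Field F] {g : ℕ}

/-- The residue at `β i` of the rational function `∏ (z - α k) / (z - β k)`. -/
def residue (α β : Fin g → F) (i : Fin g) : F :=
  (β i - α i) * ∏ k ∈ Finset.univ.erase i, (β i - α k) / (β i - β k)

theorem prod_div_eq_one_add_sum_residue (α : Fin g → F) {β : Fin g → F} (hβ : β.Injective) {z : F}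
    (hz : ∀ i, z ≠ β i) :
    ∏ i, (z - α i) / (z - β i) = 1 + ∑ i, residue α β i / (z - β i) := by
  set N := Lagrange.nodal Finset.univ α
  set D := Lagrange.nodal Finset.univ β
  have hDz : D.eval z ≠ 0 := Lagrange.eval_nodal_not_at_node fun i _ => hz i
  have hdeg : (N - D).degree < (Finset.univ : Finset (Fin g)).card := by
    have := degree_sub_lt_right (p := N) (q := D)
      (by rw [Lagrange.degree_nodal, Lagrange.degree_nodal]) Lagrange.nodal_ne_zero
      (by rw [Lagrange.nodal_monic.leadingCoeff, Lagrange.nodal_monic.leadingCoeff])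
    rwa [Lagrange.degree_nodal] at this
  have hinterp : N - D = Lagrange.interpolate Finset.univ β fun i => N.eval (β i) :=
    Lagrange.eq_interpolate_of_eval_eq _ hβ.injOn hdeg fun i hi => by
      rw [eval_sub, Lagrange.eval_nodal_at_node hi, sub_zero]
  have hsum := congrArg (eval z) hinterp
  rw [Lagrange.eval_interpolate_not_at_node _ fun i _ => hz i, eval_sub] at hsum
  have hres (i : Fin g) :
      Lagrange.nodalWeight Finset.univ β i * (z - β i)⁻¹ * N.eval (β i) =
        residue α β i / (z - β i) := by
    rw [residue, Lagrange.nodalWeight, Lagrange.eval_nodal,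
      ← Finset.mul_prod_erase _ _ (Finset.mem_univ i), Finset.prod_div_distrib,
      Finset.prod_inv_distrib]
    ring
  simp only [hres] at hsum
  rw [Finset.prod_div_distrib, ← Lagrange.eval_nodal, ← Lagrange.eval_nodal, div_eq_iff hDz]
  linear_combination hsum

end PartialFractions

variable {g : ℕ} {α β : Fin g → ℝ}

namespace IsGapSystem

theorem injective_right (h : IsGapSystem α β) : β.Injective :=
  StrictMono.injective fun i k hik => (h.2 i k hik).trans (h.1 k).2.1

theorem ratio_pos (h : IsGapSystem α β) {t : ℝ} {i : Fin g} (ht : t ∉ Icc (α i) (β i)) :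
    0 < (t - α i) / (t - β i) := by
  have := (h.1 i).2.1
  rcases lt_or_ge t (α i) with hlt | hle
  · exact div_pos_of_neg_of_neg (by linarith) (by linarith)
  · have : β i < t := not_le.mp fun h' => ht ⟨hle, h'⟩
    exact div_pos (by linarith) (by linarith)

theorem notMem_Icc_of_ne (h : IsGapSystem α β) {t : ℝ} {i k : Fin g} (ht : t ∈ Icc (α i) (β i))
    (hki : k ≠ i) : t ∉ Icc (α k) (β k) := fun ht' => by
  rcases lt_or_gt_of_ne hki with hlt | hlt
  · linarith [h.2 k i hlt, ht.1, ht'.2]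
  · linarith [h.2 i k hlt, ht.2, ht'.1]

theorem residue_pos (h : IsGapSystem α β) (i : Fin g) : 0 < residue α β i :=
  have hi := (h.1 i).2.1
  mul_pos (sub_pos.mpr hi) <| Finset.prod_pos fun _ hk =>
    h.ratio_pos <| h.notMem_Icc_of_ne ⟨hi.le, le_rfl⟩ (Finset.ne_of_mem_erase hk)

theorem prod_ratio_pos (h : IsGapSystem α β) {t : ℝ} (ht : t ∉ Icc (-1) 1) :
    0 < ∏ i, (t - α i) / (t - β i) :=
  Finset.prod_pos fun i _ => h.ratio_pos fun hi =>
    ht ⟨(h.1 i).1.le.trans hi.1, hi.2.trans (h.1 i).2.2.le⟩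

theorem prod_ratio_nonpos (h : IsGapSystem α β) {t : ℝ} {i : Fin g} (ht : t ∈ Icc (α i) (β i)) :
    ∏ k, (t - α k) / (t - β k) ≤ 0 := by
  rw [← Finset.mul_prod_erase _ _ (Finset.mem_univ i)]
  exact mul_nonpos_of_nonpos_of_nonneg
    (div_nonpos_of_nonneg_of_nonpos (sub_nonneg.mpr ht.1) (sub_nonpos.mpr ht.2))
    (Finset.prod_nonneg fun _ hk =>
      (h.ratio_pos <| h.notMem_Icc_of_ne ht (Finset.ne_of_mem_erase hk)).le)

theorem prod_ratio_eq_complex (h : IsGapSystem α β) {z : ℂ} (hz : ∀ i, z ≠ β i) :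
    ∏ i, (z - α i) / (z - β i) = 1 + ∑ i, ((residue α β i : ℝ) : ℂ) / (z - β i) := by
  have hβ : Function.Injective fun i => (β i : ℂ) :=
    Complex.ofReal_injective.comp h.injective_right
  rw [prod_div_eq_one_add_sum_residue (fun i => (α i : ℂ)) hβ hz]
  simp only [residue]
  push_cast
  rfl

/-- Each partial fraction maps the upper half-plane to the lower one. -/
theorem prod_ratio_mem_slitPlane (h : IsGapSystem α β) {z : ℂ}
    (hz : z.im = 0 → z.re ∉ Icc (-1 : ℝ) 1) :
    ∏ i, (z - α i) / (z - β i) ∈ Complex.slitPlane := by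
  by_cases him : z.im = 0
  · obtain ⟨x, rfl⟩ : ∃ x : ℝ, z = x := ⟨z.re, Complex.ext rfl him⟩
    exact_mod_cast Complex.ofReal_mem_slitPlane.mpr (h.prod_ratio_pos (hz him))
  · have hne (i : Fin g) : z ≠ β i := fun h' => him (by rw [h', Complex.ofReal_im])
    rcases isEmpty_or_nonempty (Fin g) with _ | _
    · simp
    have hsum : (∏ i, (z - α i) / (z - β i)).im =
        -(∑ i, residue α β i / Complex.normSq (z - β i)) * z.im := by
      rw [h.prod_ratio_eq_complex hne, Complex.add_im, Complex.im_sum, Complex.one_im, zero_add,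
        neg_mul, Finset.sum_mul, ← Finset.sum_neg_distrib]
      refine Finset.sum_congr rfl fun i _ => ?_
      rw [Complex.div_im, Complex.ofReal_im, Complex.ofReal_re, Complex.sub_im, Complex.ofReal_im]
      ring
    have hpos : 0 < ∑ i, residue α β i / Complex.normSq (z - β i) :=
      Finset.sum_pos (fun i _ => div_pos (h.residue_pos i)
        (Complex.normSq_pos.mpr (sub_ne_zero.mpr (hne i)))) Finset.univ_nonempty
    exact Or.inr (by rw [hsum]; exact mul_ne_zero (neg_ne_zero.mpr hpos.ne') him)

end IsGapSystem

theorem continuous_poissonKernel_circleMap {v : ℂ} (hv : v ∈ Metric.ball 0 1) :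
    Continuous fun θ => poissonKernel 0 v (circleMap 0 1 θ) := by
  have hne (θ : ℝ) : ‖circleMap 0 1 θ - 0 - (v - 0)‖ ^ 2 ≠ 0 := by
    have : circleMap 0 1 θ ≠ v := fun h => by
      rw [← h, mem_ball_zero_iff, norm_circleMap_zero] at hv
      exact absurd hv (by norm_num)
    simpa [sub_eq_zero] using this
  unfold poissonKernel
  exact Continuous.div (by fun_prop) (by fun_prop) hne

theorem ofReal_mul_mem_ball {R : ℝ} (hR : R ∈ Ioo (0 : ℝ) 1) {z : ℂ} (hz : ‖z‖ ≤ 1) :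
    (R : ℂ) * z ∈ Metric.ball 0 1 := by
  rw [mem_ball_zero_iff, norm_mul, Complex.norm_real, Real.norm_of_nonneg hR.1.le]
  exact (mul_le_of_le_one_right hR.1.le hz).trans_lt hR.2

theorem ofReal_mul_circleMap_one (R θ : ℝ) : (R : ℂ) * circleMap 0 1 θ = circleMap 0 R θ := by
  simp [circleMap_zero]

theorem re_mul_eq_poisson_integral {F : ℂ → ℂ} (hF : DifferentiableOn ℂ F (Metric.ball 0 1))
    {R : ℝ} (hR : R ∈ Ioo (0 : ℝ) 1) {v : ℂ} (hv : v ∈ Metric.ball 0 1) :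
    (F (R * v)).re = (2 * Real.pi)⁻¹ *
      ∫ θ in 0..2 * Real.pi, poissonKernel 0 v (circleMap 0 1 θ) * (F (circleMap 0 R θ)).re := by
  have hharm : InnerProductSpace.HarmonicOnNhd (fun z => (F (R * z)).re)
      (Metric.closedBall 0 1) := fun z hz => by
    have hRz := ofReal_mul_mem_ball hR (by simpa using hz)
    exact AnalyticAt.harmonicAt_re (f := fun z => F (R * z))
      ((hF.analyticAt (Metric.isOpen_ball.mem_nhds hRz)).fun_comp
        (f := fun z : ℂ => (R : ℂ) * z) (by fun_prop))
  rw [← hharm.circleAverage_poissonKernel_smul hv, Real.circleAverage_def, smul_eq_mul]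
  simp only [Pi.smul_apply', smul_eq_mul, ofReal_mul_circleMap_one]

theorem re_eq_poisson_integral_of_dominated {F : ℂ → ℂ} {f bound : ℝ → ℝ}
    (hF : DifferentiableOn ℂ F (Metric.ball 0 1))
    (hbound : IntervalIntegrable bound volume 0 (2 * Real.pi))
    (hle : ∀ R ∈ Ioo (0 : ℝ) 1, ∀ᵐ θ, |(F (circleMap 0 R θ)).re| ≤ bound θ)
    (hlim : ∀ᵐ θ, Tendsto (fun R => (F (circleMap 0 R θ)).re) (𝓝[<] 1) (𝓝 (f θ)))
    {v : ℂ} (hv : v ∈ Metric.ball 0 1) :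
    (F v).re = (2 * Real.pi)⁻¹ *
      ∫ θ in 0..2 * Real.pi, poissonKernel 0 v (circleMap 0 1 θ) * f θ := by
  have hR : ∀ᶠ R in 𝓝[<] (1 : ℝ), R ∈ Ioo 0 1 := Ioo_mem_nhdsLT one_pos
  have hcont : Tendsto (fun R : ℝ => (F (R * v)).re) (𝓝[<] 1) (𝓝 (F v).re) := by
    have hFv := (hF.differentiableAt (Metric.isOpen_ball.mem_nhds hv)).continuousAt
    have : Tendsto (fun R : ℝ => (R : ℂ) * v) (𝓝 1) (𝓝 v) :=
      Continuous.tendsto' (by fun_prop) _ _ (by simp)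
    exact (Complex.continuous_re.tendsto _).comp
      (hFv.tendsto.comp (this.mono_left nhdsWithin_le_nhds))
  have hker := continuous_poissonKernel_circleMap hv
  refine tendsto_nhds_unique
    (hcont.congr' (hR.mono fun R hR => re_mul_eq_poisson_integral hF hR hv))
    (Tendsto.const_mul _ ?_)
  refine intervalIntegral.tendsto_integral_filter_of_dominated_convergence
    (fun θ => |poissonKernel 0 v (circleMap 0 1 θ)| * bound θ) (hR.mono fun R hR => ?_)
    (hR.mono fun R hR => (hle R hR).mono fun θ hθ _ => ?_)
    (hbound.continuousOn_mul hker.abs.continuousOn)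
    (hlim.mono fun θ hθ _ => hθ.const_mul _)
  · have hFR : Continuous fun θ => F (R * circleMap 0 1 θ) :=
      hF.continuousOn.comp_continuous (by fun_prop) fun θ => ofReal_mul_mem_ball hR (by simp)
    simp only [ofReal_mul_circleMap_one] at hFR
    exact (hker.mul (Complex.continuous_re.comp hFR)).aestronglyMeasurable
  · rw [Real.norm_eq_abs, abs_mul]
    exact mul_le_mul_of_nonneg_left hθ (abs_nonneg _)

theorem sqrt_add_le (x y : ℝ) : √(x + y) ≤ √x + √y := by
  have hle (t : ℝ) : t ≤ √t ^ 2 := Real.sqrt_le_iff.mp le_rfl |>.2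
  refine Real.sqrt_le_iff.mpr ⟨by positivity, (add_le_add (hle x) (hle y)).trans ?_⟩
  nlinarith [mul_nonneg x.sqrt_nonneg y.sqrt_nonneg]

theorem intervalIntegrable_sqrt_inv_abs (A B : ℝ) :
    IntervalIntegrable (fun t : ℝ => √(|t|⁻¹)) volume A B := by
  have h := (intervalIntegral.intervalIntegrable_cpow' (a := A) (b := B)
    (r := ((-(1 / 2) : ℝ) : ℂ)) (by norm_num)).norm
  simpa only [Complex.norm_cpow_real, Complex.norm_real, Real.norm_eq_abs, Real.sqrt_eq_rpow,
    Real.rpow_neg (abs_nonneg _), Real.inv_rpow (abs_nonneg _)] using h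

theorem intervalIntegrable_sqrt_inv_abs_sin (A B : ℝ) :
    IntervalIntegrable (fun t : ℝ => √(|Real.sin t|⁻¹)) volume A B := by
  have hper : Function.Periodic (fun t : ℝ => √(|Real.sin t|⁻¹)) Real.pi := fun t => by
    simp only [Real.sin_add_pi, abs_neg]
  refine hper.intervalIntegrable Real.pi_ne_zero (t := -(Real.pi / 2)) ?_ A B
  refine ((intervalIntegrable_sqrt_inv_abs _ _).const_mul √((2 / Real.pi)⁻¹)).mono_fun'
    (by fun_prop) ?_
  filter_upwards [ae_restrict_mem measurableSet_uIoc, ae_restrict_of_ae (Measure.ae_ne volume 0)]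
    with t ht ht0
  rw [uIoc_of_le (by linarith [Real.pi_pos])] at ht
  have hsin := Real.mul_abs_le_abs_sin (abs_le.mpr ⟨ht.1.le, by linarith [ht.2]⟩)
  rw [Real.norm_of_nonneg (Real.sqrt_nonneg _), ← Real.sqrt_mul (by positivity), ← mul_inv]
  gcongr

theorem sqrt_inv_abs_cos_sub_cos_le {φ : ℝ} (hφ : 0 < Real.sin φ) (θ : ℝ) :
    √(|Real.cos θ - Real.cos φ|⁻¹) ≤ √((2 * Real.sin φ)⁻¹) *
      (√(|Real.sin ((θ + φ) / 2)|⁻¹) + √(|Real.sin ((θ - φ) / 2)|⁻¹)) := by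
  set p := Real.sin ((θ + φ) / 2) with hp
  set q := Real.sin ((θ - φ) / 2) with hq
  have hcos : |Real.cos θ - Real.cos φ| = 2 * (|p| * |q|) := by
    rw [Real.cos_sub_cos, abs_mul, abs_mul, abs_neg, abs_two, mul_assoc]
  rcases eq_or_ne (p * q) 0 with h0 | h0
  · rw [hcos, ← abs_mul, h0, abs_zero, mul_zero, inv_zero, Real.sqrt_zero]
    positivity
  obtain ⟨hp0, hq0⟩ : 0 < |p| ∧ 0 < |q| :=
    ⟨abs_pos.mpr (left_ne_zero_of_mul h0), abs_pos.mpr (right_ne_zero_of_mul h0)⟩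
  have hsum : Real.sin φ ≤ |p| + |q| := by
    have : Real.sin φ = p * Real.cos ((θ - φ) / 2) - Real.cos ((θ + φ) / 2) * q := by
      rw [hp, hq, ← Real.sin_sub]
      ring_nf
    rw [this]
    refine (le_abs_self _).trans ((abs_sub _ _).trans ?_)
    rw [abs_mul, abs_mul]
    exact add_le_add (mul_le_of_le_one_right hp0.le (Real.abs_cos_le_one _))
      (mul_le_of_le_one_left hq0.le (Real.abs_cos_le_one _))
  have hinv : (2 * (|p| * |q|))⁻¹ ≤ (2 * Real.sin φ)⁻¹ * (|p|⁻¹ + |q|⁻¹) := by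
    rw [inv_add_inv hp0.ne' hq0.ne', ← div_eq_inv_mul, div_div, inv_eq_one_div,
      div_le_div_iff₀ (by positivity) (by positivity)]
    nlinarith [mul_pos hp0 hq0]
  calc √(|Real.cos θ - Real.cos φ|⁻¹)
      ≤ √((2 * Real.sin φ)⁻¹ * (|p|⁻¹ + |q|⁻¹)) := by rw [hcos]; exact Real.sqrt_le_sqrt hinv
    _ ≤ √((2 * Real.sin φ)⁻¹) * (√(|p|⁻¹) + √(|q|⁻¹)) := by
      rw [Real.sqrt_mul (by positivity)]
      exact mul_le_mul_of_nonneg_left (sqrt_add_le _ _) (Real.sqrt_nonneg _)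

theorem intervalIntegrable_sqrt_inv_abs_cos_sub {c : ℝ} (hc : c ∈ Ioo (-1) 1) (A B : ℝ) :
    IntervalIntegrable (fun θ => √(|Real.cos θ - c|⁻¹)) volume A B := by
  have hφ : 0 < Real.sin (Real.arccos c) := by
    rw [Real.sin_arccos, Real.sqrt_pos]
    nlinarith [hc.1, hc.2]
  have hcos : Real.cos (Real.arccos c) = c := Real.cos_arccos hc.1.le hc.2.le
  have hhalf (d : ℝ) : IntervalIntegrable (fun θ => √(|Real.sin ((θ + d) / 2)|⁻¹)) volume A B := by
    have h := (intervalIntegrable_sqrt_inv_abs_sin ((A + d) / 2) ((B + d) / 2)).comp_mul_right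
      (c := 2⁻¹)
    have h' := h.comp_add_right d
    simpa [div_eq_mul_inv] using h'
  refine (((hhalf (Real.arccos c)).add (hhalf (-Real.arccos c))).const_mul
    √((2 * Real.sin (Real.arccos c))⁻¹)).mono_fun' (by fun_prop) (ae_of_all _ fun θ => ?_)
  beta_reduce
  rw [Real.norm_of_nonneg (Real.sqrt_nonneg _)]
  simpa only [hcos, sub_eq_add_neg] using sqrt_inv_abs_cos_sub_cos_le hφ θ

theorem ae_cos_ne (c : ℝ) : ∀ᵐ θ : ℝ, Real.cos θ ≠ c := by
  by_cases hc : ∃ φ, Real.cos φ = c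
  · obtain ⟨φ, rfl⟩ := hc
    have hcount : {θ | Real.cos θ = Real.cos φ}.Countable := by
      refine ((countable_range fun k : ℤ => 2 * k * Real.pi + φ).union
        (countable_range fun k : ℤ => 2 * k * Real.pi - φ)).mono fun θ hθ => ?_
      obtain ⟨k, hk | hk⟩ := Real.cos_eq_cos_iff.mp (Eq.symm hθ)
      · exact Or.inl ⟨k, hk.symm⟩
      · exact Or.inr ⟨k, hk.symm⟩
    exact hcount.ae_notMem volume
  · exact ae_of_all _ fun θ h => hc ⟨θ, h⟩

/-- The Joukowski map, from the punctured unit disc onto the complement of `[-1, 1]`. -/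
noncomputable def joukowski (v : ℂ) : ℂ := (v + v⁻¹) / 2

theorem joukowski_circleMap (R θ : ℝ) :
    joukowski (circleMap 0 R θ) =
      ⟨(R + R⁻¹) / 2 * Real.cos θ, (R - R⁻¹) / 2 * Real.sin θ⟩ := by
  have h : joukowski (circleMap 0 R θ) = (R * Complex.exp (θ * Complex.I) +
      (R : ℂ)⁻¹ * Complex.exp (-θ * Complex.I)) / 2 := by
    rw [joukowski, circleMap_zero, mul_inv, ← Complex.exp_neg, neg_mul]
  rw [h, Complex.exp_mul_I, Complex.exp_mul_I, Complex.cos_neg, Complex.sin_neg]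
  apply Complex.ext <;>
  · simp [-Complex.ofReal_cos, -Complex.ofReal_sin, ← Complex.ofReal_cos, ← Complex.ofReal_sin,
      ← Complex.ofReal_inv]
    ring

theorem joukowski_re_notMem {v : ℂ} (hv0 : v ≠ 0) (hv : ‖v‖ < 1) (him : (joukowski v).im = 0) :
    (joukowski v).re ∉ Icc (-1) 1 := by
  have hv0' := norm_pos_iff.mpr hv0
  have hinv := (one_lt_inv₀ hv0').mpr hv
  have hprod := mul_inv_cancel₀ hv0'.ne'
  rw [← Complex.norm_mul_exp_arg_mul_I v, ← circleMap_zero, joukowski_circleMap] at him ⊢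
  have hsin : Real.sin v.arg = 0 := (mul_eq_zero.mp him).resolve_left (by linarith)
  have hcos : |Real.cos v.arg| = 1 := by
    rcases Real.sin_eq_zero_iff_cos_eq.mp hsin with h | h <;> simp [h]
  rw [mem_Icc, ← abs_le, abs_mul, hcos, mul_one, abs_of_pos (by linarith), not_le]
  nlinarith

theorem abs_cos_sub_le_norm_joukowski_sub {R : ℝ} (hR : 0 < R) (θ : ℝ) {c : ℝ} (hc : |c| ≤ 1) :
    |Real.cos θ - c| ≤ ‖joukowski (circleMap 0 R θ) - c‖ := by
  rw [joukowski_circleMap, ← sq_le_sq₀ (abs_nonneg _) (norm_nonneg _), sq_abs, Complex.sq_norm,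
    Complex.normSq_apply, Complex.sub_re, Complex.sub_im, Complex.ofReal_re, Complex.ofReal_im]
  set A := (R + R⁻¹) / 2
  have hA : 1 ≤ A := by
    have : 0 ≤ (R - 1) ^ 2 * R⁻¹ := by positivity
    have e : (R - 1) ^ 2 * R⁻¹ = R + R⁻¹ - 2 := by field_simp; ring
    simp only [A]; linarith
  have hB : ((R - R⁻¹) / 2) ^ 2 = A ^ 2 - 1 := by
    simp only [A]; field_simp; ring
  have hcs : c * Real.cos θ ≤ 1 :=
    (le_abs_self _).trans (abs_mul c _ ▸ mul_le_one₀ hc (abs_nonneg _) (Real.abs_cos_le_one θ))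
  have hdiff : (A * Real.cos θ - c) * (A * Real.cos θ - c) +
      ((R - R⁻¹) / 2 * Real.sin θ - 0) * ((R - R⁻¹) / 2 * Real.sin θ - 0) -
      (Real.cos θ - c) ^ 2 = (A - 1) * (A + 1 - 2 * (c * Real.cos θ)) := by
    linear_combination Real.sin θ ^ 2 * hB + (A ^ 2 - 1) * Real.sin_sq_add_cos_sq θ
  nlinarith [mul_nonneg (sub_nonneg.mpr hA)
    (show 0 ≤ A + 1 - 2 * (c * Real.cos θ) by linarith)]

variable {g : ℕ} {α β : Fin g → ℝ}

/-- The rational function `∏ (z - α i) / (z - β i)` at `z = (v + v⁻¹) / 2`, written so that it is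
analytic at `v = 0`. -/
noncomputable def discRatio (α β : Fin g → ℝ) (v : ℂ) : ℂ :=
  ∏ i, (v ^ 2 - 2 * α i * v + 1) / (v ^ 2 - 2 * β i * v + 1)

theorem sq_sub_add_one_eq {v : ℂ} (hv : v ≠ 0) (c : ℂ) :
    v ^ 2 - 2 * c * v + 1 = 2 * v * (joukowski v - c) := by
  rw [joukowski]; field_simp; ring

theorem discRatio_eq_prod {v : ℂ} (hv : v ≠ 0) :
    discRatio α β v = ∏ i, (joukowski v - α i) / (joukowski v - β i) :=
  Finset.prod_congr rfl fun i _ => by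
    rw [sq_sub_add_one_eq hv, sq_sub_add_one_eq hv, mul_div_mul_left _ _ (by simpa using hv)]

theorem discRatio_zero : discRatio α β 0 = 1 := by simp [discRatio]

theorem sq_sub_add_one_ne_zero {v : ℂ} (hv : ‖v‖ < 1) {c : ℝ} (hc : c ∈ Icc (-1) 1) :
    v ^ 2 - 2 * c * v + 1 ≠ 0 := by
  rcases eq_or_ne v 0 with rfl | hv0
  · simp
  rw [sq_sub_add_one_eq hv0]
  refine mul_ne_zero (by simpa using hv0) (sub_ne_zero.mpr fun h => ?_)
  exact joukowski_re_notMem hv0 hv (by rw [h, Complex.ofReal_im]) (by rwa [h, Complex.ofReal_re])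

namespace IsGapSystem

theorem right_mem_Ioo (h : IsGapSystem α β) (i : Fin g) : β i ∈ Ioo (-1) 1 :=
  ⟨(h.1 i).1.trans (h.1 i).2.1, (h.1 i).2.2⟩

theorem discRatio_mem_slitPlane (h : IsGapSystem α β) {v : ℂ} (hv : ‖v‖ < 1) :
    discRatio α β v ∈ Complex.slitPlane := by
  rcases eq_or_ne v 0 with rfl | hv0
  · simp [discRatio_zero]
  · rw [discRatio_eq_prod hv0]
    exact h.prod_ratio_mem_slitPlane (joukowski_re_notMem hv0 hv)

theorem differentiableOn_sqrt_discRatio (h : IsGapSystem α β) :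
    DifferentiableOn ℂ (fun v => Complex.sqrt (discRatio α β v)) (Metric.ball 0 1) := fun v hv => by
  rw [mem_ball_zero_iff] at hv
  have hdiff : DifferentiableAt ℂ (discRatio α β) v :=
    DifferentiableAt.fun_finsetProd fun i _ => DifferentiableAt.div (by fun_prop) (by fun_prop)
      (sq_sub_add_one_ne_zero hv (Ioo_subset_Icc_self (h.right_mem_Ioo i)))
  exact ((Complex.differentiableAt_sqrt (h.discRatio_mem_slitPlane hv)).comp v
    hdiff).differentiableWithinAt

theorem abs_re_sqrt_discRatio_le (h : IsGapSystem α β) {R : ℝ} (hR : R ∈ Ioo (0 : ℝ) 1) {θ : ℝ}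
    (hθ : ∀ i, Real.cos θ ≠ β i) :
    |(Complex.sqrt (discRatio α β (circleMap 0 R θ))).re| ≤
      1 + ∑ i, √(residue α β i) * √(|Real.cos θ - β i|⁻¹) := by
  set v := circleMap 0 R θ
  set z := joukowski v
  have hv0 : v ≠ 0 := circleMap_ne_center hR.1.ne'
  have hle (i : Fin g) : |Real.cos θ - β i| ≤ ‖z - β i‖ :=
    abs_cos_sub_le_norm_joukowski_sub hR.1 θ
      (abs_le.mpr (Ioo_subset_Icc_self (h.right_mem_Ioo i)))
  have hpos (i : Fin g) : 0 < |Real.cos θ - β i| := abs_pos.mpr (sub_ne_zero.mpr (hθ i))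
  have hne (i : Fin g) : z ≠ β i := sub_ne_zero.mp (norm_pos_iff.mp ((hpos i).trans_le (hle i)))
  have hnorm : ‖discRatio α β v‖ ≤ 1 + ∑ i, residue α β i * |Real.cos θ - β i|⁻¹ := by
    rw [discRatio_eq_prod hv0, h.prod_ratio_eq_complex hne]
    refine (norm_add_le _ _).trans ?_
    rw [norm_one]
    refine add_le_add_right ((norm_sum_le _ _).trans (Finset.sum_le_sum fun i _ => ?_)) _
    rw [norm_div, Complex.norm_real, Real.norm_of_nonneg (h.residue_pos i).le, div_eq_mul_inv]
    exact mul_le_mul_of_nonneg_left (inv_anti₀ (hpos i) (hle i)) (h.residue_pos i).le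
  calc |(Complex.sqrt (discRatio α β v)).re|
      ≤ ‖Complex.sqrt (discRatio α β v)‖ := Complex.abs_re_le_norm _
    _ = √‖discRatio α β v‖ := by
      rw [Complex.sqrt, Real.sqrt_eq_rpow, ← Complex.norm_cpow_real]
      norm_num
    _ ≤ √(1 + ∑ i, residue α β i * |Real.cos θ - β i|⁻¹) := Real.sqrt_le_sqrt hnorm
    _ ≤ 1 + ∑ i, √(residue α β i * |Real.cos θ - β i|⁻¹) := by
      refine (sqrt_add_le _ _).trans (Real.sqrt_one.symm ▸ add_le_add_right ?_ _)
      exact Finset.le_sum_of_subadditive Real.sqrt Real.sqrt_zero.le sqrt_add_le _ _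
    _ = 1 + ∑ i, √(residue α β i) * √(|Real.cos θ - β i|⁻¹) := by
      simp only [Real.sqrt_mul (h.residue_pos _).le]

end IsGapSystem

theorem tendsto_re_sqrt_discRatio {θ : ℝ} (hθ : ∀ i, Real.cos θ ≠ β i) :
    Tendsto (fun R : ℝ => (Complex.sqrt (discRatio α β (circleMap 0 R θ))).re) (𝓝[<] 1)
      (𝓝 √(∏ i, (Real.cos θ - α i) / (Real.cos θ - β i))) := by
  have hv0 : circleMap 0 1 θ ≠ 0 := circleMap_ne_center one_ne_zero
  have hcos : joukowski (circleMap 0 1 θ) = Real.cos θ := by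
    rw [joukowski_circleMap]
    apply Complex.ext <;> simp [-Complex.ofReal_cos]
  have hval : discRatio α β (circleMap 0 1 θ) =
      ((∏ i, (Real.cos θ - α i) / (Real.cos θ - β i) : ℝ) : ℂ) := by
    rw [discRatio_eq_prod hv0, hcos]
    push_cast
    rfl
  have hden (i : Fin g) : circleMap 0 1 θ ^ 2 - 2 * β i * circleMap 0 1 θ + 1 ≠ 0 := by
    rw [sq_sub_add_one_eq hv0, hcos]
    exact mul_ne_zero (by simp) (sub_ne_zero.mpr (by exact_mod_cast hθ i))
  have hcont : ContinuousAt (fun R : ℝ => discRatio α β (circleMap 0 R θ)) 1 := by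
    refine tendsto_finsetProd _ fun i _ => ContinuousAt.div ?_ ?_ (hden i) <;>
    · simp only [circleMap_zero]
      fun_prop
  have hsqrt : Continuous fun z : ℂ => (Complex.sqrt z).re := by
    simp only [Complex.sqrt, Complex.cpow_inv_two_re]
    fun_prop
  rw [← Complex.re_sqrt_ofReal, ← hval]
  exact ((hsqrt.tendsto _).comp hcont.tendsto).mono_left nhdsWithin_le_nhds

theorem integral_comp_cos_zero_two_pi (f : ℝ → ℝ) :
    ∫ θ in 0..2 * Real.pi, f (Real.cos θ) = 2 * ∫ θ in 0..Real.pi, f (Real.cos θ) := by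
  have hper : Function.Periodic (fun θ => f (Real.cos θ)) (2 * Real.pi) := fun θ => by
    simp only [Real.cos_add_two_pi]
  have hshift := hper.intervalIntegral_add_eq 0 (-Real.pi)
  rw [zero_add, show -Real.pi + 2 * Real.pi = Real.pi by ring] at hshift
  have hsymm := integral_comp_abs (f := (Iic Real.pi).indicator fun θ => f (Real.cos θ))
  rw [setIntegral_indicator measurableSet_Iic, Ioi_inter_Iic] at hsymm
  rw [hshift, intervalIntegral.integral_of_le (by linarith [Real.pi_pos]),
    intervalIntegral.integral_of_le Real.pi_pos.le, ← hsymm, ← integral_Icc_eq_integral_Ioc,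
    ← integral_indicator measurableSet_Icc]
  congr 1 with θ
  simp only [indicator_apply, mem_Icc, mem_Iic, ← abs_le, Real.cos_abs]

theorem poissonKernel_real_circleMap (r θ : ℝ) :
    poissonKernel 0 (r : ℂ) (circleMap 0 1 θ) =
      (1 - r ^ 2) / (1 - 2 * r * Real.cos θ + r ^ 2) := by
  have hden : ‖circleMap 0 1 θ - r‖ ^ 2 = 1 - 2 * r * Real.cos θ + r ^ 2 := by
    rw [Complex.sq_norm, Complex.normSq_apply, circleMap_zero, Complex.exp_mul_I]
    simp [Complex.cos_ofReal_re, Complex.sin_ofReal_re]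
    linear_combination Real.sin_sq_add_cos_sq θ
  simp [poissonKernel_def, hden]

variable {g : ℕ} {α β : Fin g → ℝ}

theorem w_eq {t : ℝ} (ht : t ∈ Icc (-1) 1) :
    w α β t = Real.pi⁻¹ * (√(∏ i, (t - α i) / (t - β i)) * √(1 - t ^ 2)⁻¹) := by
  have hsq : 0 ≤ 1 - t ^ 2 := by nlinarith [ht.1, ht.2]
  rw [w, one_div, ← Real.sqrt_mul' _ (inv_nonneg.mpr hsq), Finset.prod_div_distrib,
    ← div_eq_mul_inv, div_div, mul_comm (1 - t ^ 2)]

theorem E_subset_Icc : E α β ⊆ Icc (-1) 1 := sdiff_subset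

theorem measurableSet_E : MeasurableSet (E α β) :=
  measurableSet_Icc.diff (MeasurableSet.iUnion fun _ => measurableSet_Ioo)

namespace IsGapSystem

/-- The weight vanishes on the gaps because the radicand is nonpositive there. -/
theorem integral_mul_w (h : IsGapSystem α β) (f : ℝ → ℝ) :
    ∫ t in E α β, f t * w α β t =
      Real.pi⁻¹ * ∫ θ in 0..Real.pi,
        f (Real.cos θ) * √(∏ i, (Real.cos θ - α i) / (Real.cos θ - β i)) := by
  have hgap : ∀ t ∈ Icc (-1) 1 \ E α β, f t * w α β t = 0 := fun t ⟨ht, htE⟩ => by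
    obtain ⟨i, hi⟩ := mem_iUnion.mp (not_not.mp fun h' => htE ⟨ht, h'⟩)
    rw [w_eq ht, Real.sqrt_eq_zero_of_nonpos (h.prod_ratio_nonpos (Ioo_subset_Icc_self hi)),
      zero_mul, mul_zero, mul_zero]
  rw [← setIntegral_eq_of_subset_of_forall_sdiff_eq_zero measurableSet_Icc E_subset_Icc hgap,
    ← Polynomial.Chebyshev.integral_measureT_eq_integral_cos
      (f := fun t => f t * √(∏ i, (t - α i) / (t - β i))),
    Polynomial.Chebyshev.integral_measureT, intervalIntegral.integral_of_le (by norm_num),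
    integral_Icc_eq_integral_Ioc, ← integral_const_mul]
  refine setIntegral_congr_fun measurableSet_Ioc fun t ht => ?_
  simp only [w_eq (Ioc_subset_Icc_self ht)]
  ring

theorem re_sqrt_discRatio_ofReal (h : IsGapSystem α β) {r : ℝ} (hr : |r| < 1) :
    (Complex.sqrt (discRatio α β r)).re =
      ∫ t in E α β, (1 - r ^ 2) / (1 - 2 * r * t + r ^ 2) * w α β t := by
  have hbound : IntervalIntegrable
      (fun θ => 1 + ∑ i, √(residue α β i) * √(|Real.cos θ - β i|⁻¹)) volume 0 (2 * Real.pi) :=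
    intervalIntegrable_const.add <| by
      simpa only [Finset.sum_fn] using IntervalIntegrable.sum Finset.univ fun i _ =>
        (intervalIntegrable_sqrt_inv_abs_cos_sub (h.right_mem_Ioo i) _ _).const_mul _
  have hne : ∀ᵐ θ : ℝ, ∀ i, Real.cos θ ≠ β i := ae_all_iff.mpr fun i => ae_cos_ne (β i)
  rw [re_eq_poisson_integral_of_dominated h.differentiableOn_sqrt_discRatio hbound
    (fun R hR => hne.mono fun θ => h.abs_re_sqrt_discRatio_le hR)
    (hne.mono fun θ => tendsto_re_sqrt_discRatio) (by simpa using hr)]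
  simp only [poissonKernel_real_circleMap]
  rw [integral_comp_cos_zero_two_pi fun t =>
      (1 - r ^ 2) / (1 - 2 * r * t + r ^ 2) * √(∏ i, (t - α i) / (t - β i)), h.integral_mul_w]
  field_simp

theorem integral_w (h : IsGapSystem α β) : ∫ t in E α β, w α β t = 1 := by
  simpa [discRatio_zero] using (h.re_sqrt_discRatio_ofReal (r := 0) (by simp)).symm

theorem integrableOn_w (h : IsGapSystem α β) : IntegrableOn (w α β) (E α β) :=
  not_imp_comm.mp integral_undef (h.integral_w ▸ one_ne_zero)

/-- The substitution `x = (r + r⁻¹) / 2` turns the Poisson kernel into the Cauchy kernel. -/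
theorem integral_w_div_sub (h : IsGapSystem α β) {x : ℝ} (hx : 1 < x) :
    √(x ^ 2 - 1) * ∫ t in E α β, w α β t / (x - t) = √(∏ i, (x - α i) / (x - β i)) := by
  set s := √(x ^ 2 - 1)
  have hs0 : 0 < s := Real.sqrt_pos.mpr (by nlinarith)
  have hs : s ^ 2 = x ^ 2 - 1 := Real.sq_sqrt (by nlinarith)
  have hr0 : 0 < x - s := by nlinarith
  have hr1 : x - s < 1 := by nlinarith
  have hjouk : joukowski (x - s : ℝ) = x := by
    rw [joukowski, inv_eq_of_mul_eq_one_right (b := ((x + s : ℝ) : ℂ)) (by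
      rw [← Complex.ofReal_mul]; norm_cast; linear_combination -hs)]
    push_cast; ring
  have hF := h.re_sqrt_discRatio_ofReal (abs_lt.mpr ⟨by linarith, hr1⟩)
  rw [discRatio_eq_prod (by exact_mod_cast hr0.ne'), hjouk] at hF
  have hreal : ∏ i, ((x : ℂ) - α i) / (x - β i) = ((∏ i, (x - α i) / (x - β i) : ℝ) : ℂ) := by
    push_cast; rfl
  rw [hreal, Complex.re_sqrt_ofReal] at hF
  rw [hF, ← integral_const_mul]
  refine setIntegral_congr_fun measurableSet_E fun t ht => ?_
  have htx : 0 < x - t := by linarith [(E_subset_Icc ht).2]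
  have hnum : 1 - (x - s) ^ 2 = 2 * (x - s) * s := by linear_combination hs
  have hden : 1 - 2 * (x - s) * t + (x - s) ^ 2 = 2 * (x - s) * (x - t) := by
    linear_combination hs
  simp only [hnum, hden]
  field_simp

end IsGapSystem

section ThreeTerm

variable {R : Type*} [CommRing R]

/-- The sequence `y` solves the three-term recurrence with coefficients `c` and `a`. The recurrence
of orthogonal polynomials has `c n = X - b (n + 2)` and `a (n + 1)` in place of `a n`. -/
def IsThreeTerm (c a y : ℕ → R) : Prop :=
  ∀ n, y (n + 2) = c n * y (n + 1) - a n * y n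

namespace IsThreeTerm

variable {c a y z : ℕ → R}

theorem ext (hy : IsThreeTerm c a y) (hz : IsThreeTerm c a z) (h0 : y 0 = z 0) (h1 : y 1 = z 1)
    (n : ℕ) : y n = z n := by
  induction n using Nat.twoStepInduction with
  | zero => exact h0
  | one => exact h1
  | more n ih ih' => rw [hy, hz, ih, ih']

theorem shift (hy : IsThreeTerm c a y) (k : ℕ) :
    IsThreeTerm (fun n => c (n + k)) (fun n => a (n + k)) fun n => y (n + k) := fun n => by
  simpa only [add_right_comm] using hy (n + k)

theorem mul_left (hy : IsThreeTerm c a y) (r : R) : IsThreeTerm c a fun n => r * y n := fun n => by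
  linear_combination r * hy n

theorem add (hy : IsThreeTerm c a y) (hz : IsThreeTerm c a z) :
    IsThreeTerm c a fun n => y n + z n := fun n => by
  linear_combination hy n + hz n

theorem sub (hy : IsThreeTerm c a y) (hz : IsThreeTerm c a z) :
    IsThreeTerm c a fun n => y n - z n := fun n => by
  linear_combination hy n - hz n

theorem map {S : Type*} [CommRing S] (φ : R →+* S) (hy : IsThreeTerm c a y) :
    IsThreeTerm (fun n => φ (c n)) (fun n => φ (a n)) fun n => φ (y n) := fun n => by
  simp only [hy n, map_sub, map_mul]

theorem casoratian (hy : IsThreeTerm c a y) (hz : IsThreeTerm c a z) (n : ℕ) :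
    y n * z (n + 1) - y (n + 1) * z n =
      (∏ i ∈ Finset.range n, a i) * (y 0 * z 1 - y 1 * z 0) := by
  induction n with
  | zero => simp
  | succ n ih =>
    rw [Finset.prod_range_succ]
    linear_combination y (n + 1) * hz n - z (n + 1) * hy n + a n * ih

/-- The confluent Christoffel–Darboux step. -/
theorem wronskian_succ {a b : ℕ → R} {y : ℕ → R[X]}
    (hy : IsThreeTerm (fun n => X - C (b n)) (fun n => C (a n)) y) (n : ℕ) :
    wronskian (y (n + 1)) (y (n + 2)) =
      y (n + 1) ^ 2 + C (a n) * wronskian (y n) (y (n + 1)) := by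
  simp only [wronskian, hy n, derivative_sub, derivative_mul, derivative_X, derivative_C]
  ring

end IsThreeTerm

/-- The polynomials of the first kind of the recurrence with coefficients `a` and `b`. -/
noncomputable def firstKind (a b : ℕ → R) : ℕ → R[X]
  | 0 => 1
  | 1 => X - C (b 1)
  | n + 2 => (X - C (b (n + 2))) * firstKind a b (n + 1) - C (a (n + 1)) * firstKind a b n

/-- The polynomials of the second kind of the recurrence with coefficients `a` and `b`, which are
polynomials of the first kind of the shifted recurrence. -/
noncomputable def secondKind (a b : ℕ → R) : ℕ → R[X]
  | 0 => 0
  | n + 1 => firstKind (fun k => a (k + 1)) (fun k => b (k + 1)) n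

variable (a b : ℕ → R)

theorem isThreeTerm_firstKind :
    IsThreeTerm (fun n => X - C (b (n + 2))) (fun n => C (a (n + 1))) (firstKind a b) :=
  fun n => by rw [firstKind]

theorem isThreeTerm_secondKind :
    IsThreeTerm (fun n => X - C (b (n + 2))) (fun n => C (a (n + 1))) (secondKind a b)
  | 0 => by simp [secondKind, firstKind]
  | n + 1 => isThreeTerm_firstKind (fun k => a (k + 1)) (fun k => b (k + 1)) n

theorem casoratian_firstKind_secondKind (n : ℕ) :
    firstKind a b n * secondKind a b (n + 1) - firstKind a b (n + 1) * secondKind a b n =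
      C (∏ i ∈ Finset.range n, a (i + 1)) := by
  rw [(isThreeTerm_firstKind a b).casoratian (isThreeTerm_secondKind a b), ← map_prod]
  simp [firstKind, secondKind]

theorem monic_firstKind_and_natDegree [Nontrivial R] (n : ℕ) :
    (firstKind a b n).Monic ∧ (firstKind a b n).natDegree = n := by
  induction n using Nat.twoStepInduction with
  | zero => simp [firstKind]
  | one => simp [firstKind, monic_X_sub_C]
  | more n ih ih' =>
    have hlead := (monic_X_sub_C (b (n + 2))).mul ih'.1
    have hdeg : ((X - C (b (n + 2))) * firstKind a b (n + 1)).natDegree = n + 2 := by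
      rw [(monic_X_sub_C _).natDegree_mul ih'.1, natDegree_X_sub_C, ih'.2]
      ring
    have hlt : (C (a (n + 1)) * firstKind a b n).degree <
        ((X - C (b (n + 2))) * firstKind a b (n + 1)).degree := by
      refine degree_lt_degree ((natDegree_C_mul_le _ _).trans_lt ?_)
      omega
    rw [firstKind]
    exact ⟨hlead.sub_of_left hlt,
      (natDegree_eq_of_degree_eq (degree_sub_eq_left_of_degree_lt hlt)).trans hdeg⟩

theorem monic_firstKind (n : ℕ) : (firstKind a b n).Monic := by
  nontriviality R
  exact (monic_firstKind_and_natDegree a b n).1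

theorem natDegree_firstKind [Nontrivial R] (n : ℕ) : (firstKind a b n).natDegree = n :=
  (monic_firstKind_and_natDegree a b n).2

end ThreeTerm

/-- The normalized solutions `y n / √(a 0 ⋯ a (n - 1))` have Casoratian tending to zero, whereas
that of `y` and `z` is a multiple of `a 0 ⋯ a (n - 1)`. -/
theorem IsThreeTerm.casoratian_eq_zero_of_tendsto {c a y z : ℕ → ℝ} (hy : IsThreeTerm c a y)
    (hz : IsThreeTerm c a z) (ha : ∀ n, 0 < a n) (hbdd : BddAbove (range a))
    (hy0 : Tendsto (fun n => y n ^ 2 / ∏ i ∈ Finset.range n, a i) atTop (𝓝 0))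
    (hz0 : Tendsto (fun n => z n ^ 2 / ∏ i ∈ Finset.range n, a i) atTop (𝓝 0)) :
    y 0 * z 1 - y 1 * z 0 = 0 := by
  obtain ⟨A, hA⟩ := hbdd
  set π : ℕ → ℝ := fun n => ∏ i ∈ Finset.range n, a i
  have hπ (n : ℕ) : 0 < π n := Finset.prod_pos fun i _ => ha i
  have hsucc (n : ℕ) : π (n + 1) = π n * a n := Finset.prod_range_succ a n
  have hshift {u : ℕ → ℝ} (hu : Tendsto (fun n => u n ^ 2 / π n) atTop (𝓝 0)) :
      Tendsto (fun n => A * (u (n + 1) ^ 2 / π (n + 1))) atTop (𝓝 0) := by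
    simpa using ((tendsto_add_atTop_iff_nat 1).mpr hu).const_mul A
  have hle (u v : ℕ → ℝ) (n : ℕ) :
      |u n * v (n + 1)| / π n ≤ u n ^ 2 / π n + A * (v (n + 1) ^ 2 / π (n + 1)) := by
    have hv : v (n + 1) ^ 2 / π n ≤ A * (v (n + 1) ^ 2 / π (n + 1)) := by
      rw [hsucc, mul_div_assoc', div_le_div_iff₀ (hπ n) (mul_pos (hπ n) (ha n))]
      nlinarith [mul_nonneg (mul_nonneg (sq_nonneg (v (n + 1))) (hπ n).le)
        (sub_nonneg.mpr (hA (mem_range_self n)))]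
    refine le_trans ?_ (add_le_add_right hv _)
    rw [← add_div, abs_mul]
    refine div_le_div_of_nonneg_right ?_ (hπ n).le
    nlinarith [two_mul_le_add_sq |u n| |v (n + 1)|, sq_abs (u n), sq_abs (v (n + 1)),
      mul_nonneg (abs_nonneg (u n)) (abs_nonneg (v (n + 1)))]
  have hbound (n : ℕ) : |y 0 * z 1 - y 1 * z 0| ≤
      y n ^ 2 / π n + A * (z (n + 1) ^ 2 / π (n + 1)) +
        (z n ^ 2 / π n + A * (y (n + 1) ^ 2 / π (n + 1))) := by
    refine le_trans ?_ (add_le_add (hle y z n) (hle z y n))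
    rw [← add_div, le_div_iff₀ (hπ n), mul_comm, ← abs_of_pos (hπ n), ← abs_mul,
      ← hy.casoratian hz, mul_comm (y (n + 1))]
    exact abs_sub _ _
  have hlim := (hy0.add (hshift hz0)).add (hz0.add (hshift hy0))
  rw [add_zero, add_zero] at hlim
  exact abs_nonpos_iff.mp (ge_of_tendsto' hlim hbound)

section Favard

variable {R : Type*} [CommRing R] {a b : ℕ → R}

theorem linearMap_C_mul (L : R[X] →ₗ[R] R) (r : R) (p : R[X]) : L (C r * p) = r * L p := by
  rw [← smul_eq_C_mul, map_smul, smul_eq_mul]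

theorem divByMonic_X_sub_C_eq_of_eq {p q : R[X]} {r x : R} (h : p = C r + (X - C x) * q) :
    p /ₘ (X - C x) = q := by
  nontriviality R
  refine (div_modByMonic_unique q (C r) (monic_X_sub_C x) ⟨h.symm, ?_⟩).1
  exact degree_C_le.trans_lt (by simp)

/-- The linear functional `L` annihilates the products of distinct polynomials of the first kind and
is normalized by `L 1 = 1`. -/
structure IsOrthogonalFunctional (a b : ℕ → R) (L : R[X] →ₗ[R] R) : Prop where
  map_one : L 1 = 1
  map_mul_eq_zero {m n : ℕ} (h : m ≠ n) : L (firstKind a b m * firstKind a b n) = 0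

namespace IsOrthogonalFunctional

variable {L : R[X] →ₗ[R] R}

theorem map_firstKind_succ (hL : IsOrthogonalFunctional a b L) (n : ℕ) :
    L (firstKind a b (n + 1)) = 0 := by
  simpa [firstKind] using hL.map_mul_eq_zero n.succ_ne_zero

theorem map_sq_succ (hL : IsOrthogonalFunctional a b L) (n : ℕ) :
    L (firstKind a b (n + 1) ^ 2) = a (n + 1) * L (firstKind a b n ^ 2) := by
  have hnext : L (X * firstKind a b (n + 1) * firstKind a b n) =
      a (n + 1) * L (firstKind a b n ^ 2) := by
    have key : X * firstKind a b (n + 1) * firstKind a b n =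
        firstKind a b (n + 2) * firstKind a b n +
          C (b (n + 2)) * (firstKind a b (n + 1) * firstKind a b n) +
          C (a (n + 1)) * firstKind a b n ^ 2 := by
      rw [isThreeTerm_firstKind a b n]
      ring
    rw [key, map_add, map_add, linearMap_C_mul, linearMap_C_mul, hL.map_mul_eq_zero (by omega),
      hL.map_mul_eq_zero (by omega)]
    ring
  rw [← hnext]
  cases n with
  | zero =>
    have key : X * firstKind a b 1 * firstKind a b 0 =
        firstKind a b 1 ^ 2 + C (b 1) * (firstKind a b 1 * firstKind a b 0) := by
      simp only [firstKind]
      ring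
    rw [key, map_add, linearMap_C_mul, hL.map_mul_eq_zero one_ne_zero, mul_zero, add_zero]
  | succ n =>
    have key : X * firstKind a b (n + 2) * firstKind a b (n + 1) =
        firstKind a b (n + 2) ^ 2 +
          C (b (n + 2)) * (firstKind a b (n + 2) * firstKind a b (n + 1)) +
          C (a (n + 1)) * (firstKind a b (n + 2) * firstKind a b n) := by
      linear_combination -firstKind a b (n + 2) * isThreeTerm_firstKind a b n
    rw [key, map_add, map_add, linearMap_C_mul, linearMap_C_mul, hL.map_mul_eq_zero (by omega),
      hL.map_mul_eq_zero (by omega)]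
    ring

theorem map_sq (hL : IsOrthogonalFunctional a b L) (n : ℕ) :
    L (firstKind a b n ^ 2) = ∏ i ∈ Finset.range n, a (i + 1) := by
  induction n with
  | zero => simp [firstKind, hL.map_one]
  | succ n ih => rw [hL.map_sq_succ, ih, Finset.prod_range_succ, mul_comm]

theorem eval_secondKind (hL : IsOrthogonalFunctional a b L) (x : R) (n : ℕ) :
    (secondKind a b n).eval x = L (firstKind a b n /ₘ (X - C x)) := by
  have hquot (p : R[X]) : p = C (p.eval x) + (X - C x) * (p /ₘ (X - C x)) := by
    rw [← modByMonic_X_sub_C_eq_C_eval, modByMonic_add_div]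
  have hrec : IsThreeTerm (fun n => x - b (n + 2)) (fun n => a (n + 1))
      fun n => L (firstKind a b n /ₘ (X - C x)) := fun n => by
    have hdiv : firstKind a b (n + 2) /ₘ (X - C x) =
        C (x - b (n + 2)) * (firstKind a b (n + 1) /ₘ (X - C x)) + firstKind a b (n + 1) -
          C (a (n + 1)) * (firstKind a b n /ₘ (X - C x)) := by
      refine divByMonic_X_sub_C_eq_of_eq (r := (firstKind a b (n + 2)).eval x) ?_
      have heval := congrArg C (congrArg (eval x) (isThreeTerm_firstKind a b n))
      simp only [eval_sub, eval_mul, eval_X, eval_C, C_sub, C_mul] at heval ⊢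
      linear_combination isThreeTerm_firstKind a b n - heval +
        (C x - C (b (n + 2))) * hquot (firstKind a b (n + 1)) -
        C (a (n + 1)) * hquot (firstKind a b n)
    beta_reduce
    rw [hdiv, map_sub, map_add, linearMap_C_mul, linearMap_C_mul, hL.map_firstKind_succ, add_zero]
  have heval : IsThreeTerm (fun n => x - b (n + 2)) (fun n => a (n + 1))
      fun n => (secondKind a b n).eval x := by
    simpa using (isThreeTerm_secondKind a b).map (evalRingHom x)
  refine heval.ext hrec ?_ ?_ n
  · have hdiv : (1 : R[X]) /ₘ (X - C x) = 0 := divByMonic_X_sub_C_eq_of_eq (r := 1) (by simp)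
    simp [secondKind, firstKind, hdiv]
  · have hdiv : (X - C (b 1)) /ₘ (X - C x) = 1 :=
      divByMonic_X_sub_C_eq_of_eq (r := x - b 1) (by rw [C_sub]; ring)
    simp [secondKind, firstKind, hdiv, hL.map_one]

end IsOrthogonalFunctional

end Favard

open RealInnerProductSpace in
theorem tendsto_inner_sq_div_norm_sq {H : Type*} [NormedAddCommGroup H] [InnerProductSpace ℝ H]
    {e : ℕ → H} (hne : ∀ n, e n ≠ 0) (horth : Pairwise fun m n => ⟪e m, e n⟫ = 0) (x : H) :
    Tendsto (fun n => ⟪e n, x⟫ ^ 2 / ‖e n‖ ^ 2) atTop (𝓝 0) := by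
  have hon : Orthonormal ℝ fun n => (‖e n‖⁻¹ : ℝ) • e n :=
    ⟨fun n => norm_smul_inv_norm (𝕜 := ℝ) (hne n), fun m n hmn => by
      simp [inner_smul_left, inner_smul_right, horth hmn]⟩
  refine (hon.inner_products_summable x).tendsto_atTop_zero.congr fun n => ?_
  simp [inner_smul_left, mul_pow, div_eq_inv_mul]

theorem tendsto_integral_mul_sq_div_integral_sq {X : Type*} [MeasurableSpace X] {μ : Measure X}
    {e : ℕ → X → ℝ} {f : X → ℝ} (he : ∀ n, MemLp (e n) 2 μ) (hf : MemLp f 2 μ)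
    (hpos : ∀ n, 0 < ∫ t, e n t ^ 2 ∂μ) (horth : Pairwise fun m n => ∫ t, e m t * e n t ∂μ = 0) :
    Tendsto (fun n => (∫ t, e n t * f t ∂μ) ^ 2 / ∫ t, e n t ^ 2 ∂μ) atTop (𝓝 0) := by
  have hinner {u v : X → ℝ} (hu : MemLp u 2 μ) (hv : MemLp v 2 μ) :
      inner ℝ (hu.toLp u) (hv.toLp v) = ∫ t, u t * v t ∂μ := by
    rw [L2.inner_def]
    refine integral_congr_ae ?_
    filter_upwards [hu.coeFn_toLp, hv.coeFn_toLp] with t hut hvt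
    rw [hut, hvt, real_inner_eq_re_inner]
    simp [mul_comm]
  have hnorm (n : ℕ) : ‖(he n).toLp (e n)‖ ^ 2 = ∫ t, e n t ^ 2 ∂μ := by
    rw [← real_inner_self_eq_norm_sq, hinner]
    simp only [sq]
  have hne (n : ℕ) : (he n).toLp (e n) ≠ 0 := by
    rw [← norm_ne_zero_iff, ← sq_pos_iff, hnorm]
    exact hpos n
  simpa only [hnorm, hinner] using tendsto_inner_sq_div_norm_sq hne
    (fun m n hmn => (hinner (he m) (he n)).trans (horth hmn)) (hf.toLp f)

section Moment

variable {μ : Measure ℝ} [IsFiniteMeasure μ] {S : Set ℝ}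

theorem memLp_of_continuousOn (hS : IsCompact S) (hμ : ∀ᵐ t ∂μ, t ∈ S) {f : ℝ → ℝ}
    (hf : ContinuousOn f S) (p : ENNReal) : MemLp f p μ := by
  obtain ⟨C, hC⟩ := hS.exists_bound_of_continuousOn hf
  refine MemLp.of_bound ?_ C (hμ.mono hC)
  rw [← Measure.restrict_eq_self_of_ae_mem hμ]
  exact hf.aestronglyMeasurable hS.measurableSet

theorem integrable_of_continuousOn (hS : IsCompact S) (hμ : ∀ᵐ t ∂μ, t ∈ S) {f : ℝ → ℝ}
    (hf : ContinuousOn f S) : Integrable f μ :=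
  memLp_one_iff_integrable.mp (memLp_of_continuousOn hS hμ hf 1)

/-- The moment functional `p ↦ ∫ p dμ` of a finite measure carried by a compact set. -/
noncomputable def momentFunctional (hS : IsCompact S) (hμ : ∀ᵐ t ∂μ, t ∈ S) : ℝ[X] →ₗ[ℝ] ℝ where
  toFun p := ∫ t, p.eval t ∂μ
  map_add' p q := by
    simp only [eval_add]
    exact integral_add (integrable_of_continuousOn hS hμ p.continuousOn)
      (integrable_of_continuousOn hS hμ q.continuousOn)
  map_smul' r p := by simp [integral_const_mul]

variable (hS : IsCompact S) (hμ : ∀ᵐ t ∂μ, t ∈ S)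

theorem momentFunctional_sq_pos [NullSingletonClass μ] [NeZero μ] {p : ℝ[X]} (hp : p ≠ 0) :
    0 < momentFunctional hS hμ (p ^ 2) := by
  have hint := integrable_of_continuousOn hS hμ (p ^ 2).continuousOn
  have hnonneg (t : ℝ) : 0 ≤ (p ^ 2).eval t := by
    rw [eval_pow]
    positivity
  refine (integral_nonneg hnonneg).lt_of_ne' fun h0 => ?_
  have hroot : ∀ᵐ t ∂μ, t ∈ {t | p.IsRoot t} := by
    filter_upwards [(integral_eq_zero_iff_of_nonneg hnonneg hint).mp h0] with t ht
    simpa using ht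
  have hnull : ∀ᵐ t ∂μ, t ∉ {t | p.IsRoot t} :=
    measure_eq_zero_iff_ae_notMem.mp ((finite_setOfPred_isRoot hp).measure_zero μ)
  obtain ⟨t, h, h'⟩ := (hroot.and hnull).exists
  exact h' h

theorem integral_diffQuot [NullSingletonClass μ] (p : ℝ[X]) (x : ℝ) :
    ∫ t, (p.eval x - p.eval t) / (x - t) ∂μ = momentFunctional hS hμ (p /ₘ (X - C x)) := by
  refine integral_congr_ae ?_
  filter_upwards [compl_mem_ae_iff.mpr (measure_singleton (μ := μ) x)] with t ht
  have hquot : p.eval t = p.eval x + (t - x) * (p /ₘ (X - C x)).eval t := by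
    conv_lhs => rw [← modByMonic_add_div p (X - C x), modByMonic_X_sub_C_eq_C_eval]
    simp
  rw [hquot, div_eq_iff (sub_ne_zero.mpr (Ne.symm ht))]
  ring

end Moment

theorem bddAbove_range_of_periodic {R : Type*} [Preorder R] [IsDirectedOrder R] [Nonempty R]
    {f : ℕ → R} {M : ℕ} (hM : 0 < M) (hf : Function.Periodic f M) : BddAbove (range f) := by
  refine ((Finset.range M).finite_toSet.image f).bddAbove.mono ?_
  rintro _ ⟨n, rfl⟩
  exact ⟨n % M, by simpa using n.mod_lt hM, hf.map_mod_nat n⟩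

/-- The functions of the second kind `ψ n x = ∫ P n t / (x - t) dμ(t)`, the decaying solution of the
recurrence with coefficients `a` and `b` off the support of the orthogonality measure `μ`. -/
noncomputable def secondKindFunction (μ : Measure ℝ) (a b : ℕ → ℝ) (n : ℕ) (x : ℝ) : ℝ :=
  ∫ t, (firstKind a b n).eval t / (x - t) ∂μ

theorem continuousOn_div_sub {S : Set ℝ} {x : ℝ} (p : ℝ[X]) (hx : x ∉ S) :
    ContinuousOn (fun t => p.eval t / (x - t)) S :=
  p.continuousOn.div (by fun_prop) fun _ ht => sub_ne_zero.mpr fun h => hx (h ▸ ht)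

namespace IsOrthogonalFunctional

variable {μ : Measure ℝ} [IsFiniteMeasure μ] [NullSingletonClass μ] {S : Set ℝ} {hS : IsCompact S}
  {hμ : ∀ᵐ t ∂μ, t ∈ S} {a b : ℕ → ℝ} {x : ℝ}

theorem coeff_pos [NeZero μ] (hL : IsOrthogonalFunctional a b (momentFunctional hS hμ)) (n : ℕ) :
    0 < a (n + 1) := by
  have hpos (k : ℕ) : 0 < momentFunctional hS hμ (firstKind a b k ^ 2) :=
    momentFunctional_sq_pos hS hμ (monic_firstKind a b k).ne_zero
  have hsucc := hpos (n + 1)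
  rw [hL.map_sq_succ] at hsucc
  exact pos_of_mul_pos_left hsucc (hpos n).le

theorem integral_diffQuot_firstKind (hL : IsOrthogonalFunctional a b (momentFunctional hS hμ))
    (n : ℕ) (x : ℝ) :
    ∫ t, ((firstKind a b n).eval x - (firstKind a b n).eval t) / (x - t) ∂μ =
      (secondKind a b n).eval x := by
  rw [integral_diffQuot hS hμ, hL.eval_secondKind]

theorem secondKindFunction_eq (hL : IsOrthogonalFunctional a b (momentFunctional hS hμ))
    (hx : x ∉ S) (n : ℕ) :
    secondKindFunction μ a b n x =
      (firstKind a b n).eval x * secondKindFunction μ a b 0 x - (secondKind a b n).eval x := by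
  have hint (p : ℝ[X]) : Integrable (fun t => p.eval t / (x - t)) μ :=
    integrable_of_continuousOn hS hμ (continuousOn_div_sub p hx)
  have hone : Integrable (fun t => 1 / (x - t)) μ := by simpa using hint 1
  rw [← hL.integral_diffQuot_firstKind]
  simp only [sub_div]
  rw [integral_sub ((hone.const_mul ((firstKind a b n).eval x)).congr
    (.of_forall fun t => mul_one_div _ _)) (hint _)]
  simp [secondKindFunction, firstKind, div_eq_mul_inv, integral_const_mul]

theorem isThreeTerm_secondKindFunction
    (hL : IsOrthogonalFunctional a b (momentFunctional hS hμ)) (hx : x ∉ S) :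
    IsThreeTerm (fun n => x - b (n + 2)) (fun n => a (n + 1))
      fun n => secondKindFunction μ a b n x := fun n => by
  have hP := congrArg (eval x) (isThreeTerm_firstKind a b n)
  have hQ := congrArg (eval x) (isThreeTerm_secondKind a b n)
  simp only [eval_sub, eval_mul, eval_X, eval_C] at hP hQ
  beta_reduce
  rw [hL.secondKindFunction_eq hx (n + 2), hL.secondKindFunction_eq hx (n + 1),
    hL.secondKindFunction_eq hx n]
  linear_combination secondKindFunction μ a b 0 x * hP - hQ

theorem tendsto_secondKindFunction [NeZero μ]
    (hL : IsOrthogonalFunctional a b (momentFunctional hS hμ)) (hx : x ∉ S) (k : ℕ) :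
    Tendsto (fun n => secondKindFunction μ a b (n + k) x ^ 2 /
      ∏ i ∈ Finset.range n, a (i + k + 1)) atTop (𝓝 0) := by
  have hcont : ContinuousOn (fun t => 1 / (x - t)) S := by
    simpa using continuousOn_div_sub 1 hx
  have hpos (n : ℕ) : 0 < ∫ t, (firstKind a b n).eval t ^ 2 ∂μ := by
    simpa [momentFunctional] using
      momentFunctional_sq_pos hS hμ (monic_firstKind a b n).ne_zero
  have horth :
      Pairwise fun m n => ∫ t, (firstKind a b m).eval t * (firstKind a b n).eval t ∂μ = 0 :=
    fun m n hmn => by simpa [momentFunctional] using hL.map_mul_eq_zero hmn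
  have hbessel := tendsto_integral_mul_sq_div_integral_sq
    (fun n => memLp_of_continuousOn hS hμ (firstKind a b n).continuousOn 2)
    (memLp_of_continuousOn hS hμ hcont 2) hpos horth
  have hsq (n : ℕ) : ∫ t, (firstKind a b n).eval t ^ 2 ∂μ = ∏ i ∈ Finset.range n, a (i + 1) := by
    simpa [momentFunctional] using hL.map_sq n
  simp only [mul_one_div, hsq] at hbessel
  have hlim := ((tendsto_add_atTop_iff_nat k).mpr hbessel).const_mul
    (∏ i ∈ Finset.range k, a (i + 1))
  rw [mul_zero] at hlim
  refine hlim.congr fun n => ?_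
  have hk : ∏ i ∈ Finset.range k, a (i + 1) ≠ 0 :=
    Finset.prod_ne_zero_iff.mpr fun i _ => (hL.coeff_pos i).ne'
  rw [add_comm n k, Finset.prod_range_add, mul_div_assoc', mul_div_mul_left _ _ hk]
  simp only [secondKindFunction, add_comm k]

/-- The decaying solution and its translate by a period are proportional. -/
theorem secondKindFunction_periodic [NeZero μ]
    (hL : IsOrthogonalFunctional a b (momentFunctional hS hμ)) (hx : x ∉ S) {M : ℕ} (hM : 0 < M)
    (hb : ∀ n, 1 ≤ n → b (n + M) = b n) (ha : ∀ n, 2 ≤ n → a (n + M) = a n) :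
    a 1 * (secondKindFunction μ a b 0 x * secondKindFunction μ a b (M + 1) x) =
      a (M + 1) * (secondKindFunction μ a b 1 x * secondKindFunction μ a b M x) := by
  set ψ : ℕ → ℝ := fun n => secondKindFunction μ a b n x
  have hψ : IsThreeTerm (fun n => x - b (n + 2)) (fun n => a (n + 1)) ψ :=
    hL.isThreeTerm_secondKindFunction hx
  have hperiod (n : ℕ) : a (n + (M + 1) + 1) = a (n + 1 + 1) := by
    rw [← ha (n + 1 + 1) (by omega)]
    congr 1
    omega
  have hbdd : BddAbove (range fun n => a (n + 1 + 1)) := bddAbove_range_of_periodic hM hperiod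
  have hshift : IsThreeTerm (fun n => x - b (n + 1 + 2)) (fun n => a (n + 1 + 1))
      fun n => ψ (n + (M + 1)) := fun n => by
    have hrec := hψ.shift (M + 1) n
    have hbn : b (n + (M + 1) + 2) = b (n + 1 + 2) := by
      rw [← hb (n + 1 + 2) (by omega)]
      congr 1
      omega
    simpa only [hperiod, hbn] using hrec
  have hcas := (hψ.shift 1).casoratian_eq_zero_of_tendsto hshift (fun n => hL.coeff_pos _) hbdd
    (hL.tendsto_secondKindFunction hx 1)
    (by simpa only [hperiod] using hL.tendsto_secondKindFunction hx (M + 1))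
  have hb2 : b (M + 2) = b 2 := by rw [add_comm, hb 2 one_le_two]
  have h2 := hψ 0
  have hM2 := hψ M
  simp only [hb2, zero_add] at h2 hM2 hcas
  rw [show 1 + (M + 1) = M + 2 by ring] at hcas
  linear_combination hcas - ψ 1 * hM2 + ψ (M + 1) * h2

end IsOrthogonalFunctional

section Quadratic

variable {R : Type*} [CommRing R] [IsDomain R]

theorem eq_zero_of_sq_mul_eq_sq_mul {U V N D : R[X]} {x : R} (hN : N ≠ 0)
    (hNx : Even (rootMultiplicity x N)) (hDx : Odd (rootMultiplicity x D))
    (h : U ^ 2 * D = V ^ 2 * N) : U = 0 ∧ V = 0 := by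
  have hD : D ≠ 0 := by
    rintro rfl
    simp at hDx
  have hiff : U = 0 ↔ V = 0 := by
    constructor <;> rintro rfl <;> simpa [hN, hD, eq_comm] using h
  refine (and_iff_left_of_imp hiff.mp).mpr (by_contra fun hU => ?_)
  have hV := hiff.not.mp hU
  have hmult := congrArg (rootMultiplicity x) h
  rw [rootMultiplicity_mul (mul_ne_zero (pow_ne_zero 2 hU) hD),
    rootMultiplicity_mul (mul_ne_zero (pow_ne_zero 2 hV) hN), sq, sq,
    rootMultiplicity_mul (mul_ne_zero hU hU), rootMultiplicity_mul (mul_ne_zero hV hV)] at hmult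
  grind

/-- A polynomial with a root of odd multiplicity has no rational square root, so `√(N / D)`
satisfies only the obvious quadratic equations. -/
theorem eq_zero_of_quadratic {A B C N D : R[X]} {x : R} (hN : N ≠ 0)
    (hNx : Even (rootMultiplicity x N)) (hDx : Odd (rootMultiplicity x D)) {T : Set R}
    (hT : T.Infinite) {f : R → R} (hf : ∀ t ∈ T, f t ^ 2 * D.eval t = N.eval t)
    (h : ∀ t ∈ T, A.eval t * f t ^ 2 + B.eval t * f t + C.eval t = 0) :
    B = 0 ∧ A * N + C * D = 0 := by
  have hsq : (A * N + C * D) ^ 2 * D = (B * D) ^ 2 * N :=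
    eq_of_infinite_eval_eq _ _ <| hT.mono fun t ht => by
      have hft := hf t ht
      simp only [mem_ofPred_eq, eval_mul, eval_add, eval_pow, ← hft]
      linear_combination (D.eval t) ^ 3 *
        (A.eval t * f t ^ 2 - B.eval t * f t + C.eval t) * h t ht
  obtain ⟨hU, hV⟩ := eq_zero_of_sq_mul_eq_sq_mul hN hNx hDx hsq
  refine ⟨(mul_eq_zero.mp hV).resolve_right ?_, hU⟩
  rintro rfl
  simp at hDx

end Quadratic

/-- `M` is a period of the recurrence coefficients `b n` (`n ≥ 1`) and `a n` (`n ≥ 2`), and the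
linear part of the quadratic equation of the Stieltjes transform that comes from `M` vanishes, as it
must when the transform is of the form `√(N / D)`. -/
structure IsPeriod (a b : ℕ → ℝ) (M : ℕ) : Prop where
  pos : 0 < M
  coeff_pos (n : ℕ) : 0 < a (n + 1)
  coeff_b {n : ℕ} (hn : 1 ≤ n) : b (n + M) = b n
  coeff_a {n : ℕ} (hn : 2 ≤ n) : a (n + M) = a n
  coeff_one : a 1 = 2 * a (M + 1)
  two_mul_secondKind :
    2 * secondKind a b (M + 1) = firstKind a b M + firstKind a b 1 * secondKind a b M

/-- The leading coefficient `G = 2 P_{M+1} - P_1 P_M` of the quadratic equation `G f ^ 2 = Q_M` that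
a period `M` imposes on the Stieltjes transform `f` of the weight. -/
noncomputable def periodPoly (a b : ℕ → ℝ) (M : ℕ) : ℝ[X] :=
  2 * firstKind a b (M + 1) - firstKind a b 1 * firstKind a b M

theorem coeff_one_eq_two_mul {a b : ℕ → ℝ} {M : ℕ} (hM : 0 < M) {c : ℝ}
    (h : C (a 1) * secondKind a b (M + 1) =
      C c * (firstKind a b M + firstKind a b 1 * secondKind a b M)) : a 1 = 2 * c := by
  obtain ⟨m, rfl⟩ : ∃ m, M = m + 1 := ⟨M - 1, by omega⟩
  have hlead {p : ℝ[X]} (hp : p.Monic) (hd : p.natDegree = m + 1) : p.coeff (m + 1) = 1 :=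
    hd ▸ hp.coeff_natDegree
  have hfst (a b : ℕ → ℝ) : (firstKind a b (m + 1)).coeff (m + 1) = 1 :=
    hlead (monic_firstKind a b _) (natDegree_firstKind a b _)
  have hprod (a' b' : ℕ → ℝ) : (firstKind a b 1 * firstKind a' b' m).coeff (m + 1) = 1 := by
    refine hlead ((monic_firstKind a b 1).mul (monic_firstKind a' b' m)) ?_
    rw [(monic_firstKind a b 1).natDegree_mul (monic_firstKind a' b' m), natDegree_firstKind,
      natDegree_firstKind, add_comm]
  have hcoeff := congrArg (coeff · (m + 1)) h
  simp only [coeff_C_mul, coeff_add, hprod, hfst, secondKind] at hcoeff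
  linarith

/-- `hf` says that the Stieltjes transform of `μ` is `√(N / D)`. Comparing this with the quadratic
equation that the period forces on the Stieltjes transform determines all its coefficients. -/
theorem IsOrthogonalFunctional.isPeriod {μ : Measure ℝ} [IsFiniteMeasure μ] [NullSingletonClass μ]
    [NeZero μ] {S : Set ℝ} {hS : IsCompact S} {hμ : ∀ᵐ t ∂μ, t ∈ S} {a b : ℕ → ℝ}
    (hL : IsOrthogonalFunctional a b (momentFunctional hS hμ)) {N D : ℝ[X]} {x₀ : ℝ} (hN : N ≠ 0)
    (hNx : Even (rootMultiplicity x₀ N)) (hDx : Odd (rootMultiplicity x₀ D)) {T : Set ℝ}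
    (hT : T.Infinite) (hTS : Disjoint T S)
    (hf : ∀ x ∈ T, (∫ t, 1 / (x - t) ∂μ) ^ 2 * D.eval x = N.eval x) {M : ℕ} (hM : 0 < M)
    (hb : ∀ n, 1 ≤ n → b (n + M) = b n) (ha : ∀ n, 2 ≤ n → a (n + M) = a n) :
    IsPeriod a b M ∧ periodPoly a b M * N = secondKind a b M * D := by
  set c := a (M + 1)
  have hzero (x : ℝ) : secondKindFunction μ a b 0 x = ∫ t, 1 / (x - t) ∂μ := by
    simp [secondKindFunction, firstKind]
  obtain ⟨hB, hA⟩ := eq_zero_of_quadratic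
    (A := C c * (firstKind a b 1 * firstKind a b M) - C (a 1) * firstKind a b (M + 1))
    (B := C (a 1) * secondKind a b (M + 1) -
      C c * (firstKind a b M + firstKind a b 1 * secondKind a b M))
    (C := C c * secondKind a b M) hN hNx hDx hT hf fun x hx => by
      have hxS := disjoint_left.mp hTS hx
      have key := hL.secondKindFunction_periodic hxS hM hb ha
      rw [hL.secondKindFunction_eq hxS 1, hL.secondKindFunction_eq hxS M,
        hL.secondKindFunction_eq hxS (M + 1), hzero] at key
      simp only [eval_add, eval_sub, eval_mul, eval_C, secondKind, firstKind, eval_one] at key ⊢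
      linear_combination -key
  have hcoeff := coeff_one_eq_two_mul hM (sub_eq_zero.mp hB)
  have hc : (C c : ℝ[X]) ≠ 0 := C_ne_zero.mpr (hL.coeff_pos M).ne'
  rw [hcoeff, C_mul, C_ofNat] at hA hB
  refine ⟨⟨hM, hL.coeff_pos, fun hn => hb _ hn, fun hn => ha _ hn, hcoeff, ?_⟩, ?_⟩
  · exact mul_left_cancel₀ hc (by linear_combination hB)
  · exact mul_left_cancel₀ hc (by rw [periodPoly]; linear_combination -hA)

section Weight

variable {g : ℕ} {α β : Fin g → ℝ}

theorem w_nonneg (x : ℝ) : 0 ≤ w α β x := by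
  rw [w]
  positivity

theorem measurable_w : Measurable (w α β) := by
  unfold w
  fun_prop

/-- The measure `w(x) dx` on `E`. -/
noncomputable def weightMeasure (α β : Fin g → ℝ) : Measure ℝ :=
  (volume.restrict (E α β)).withDensity fun x => ENNReal.ofReal (w α β x)

theorem integral_weightMeasure (f : ℝ → ℝ) :
    ∫ t, f t ∂weightMeasure α β = ∫ t in E α β, f t * w α β t := by
  rw [weightMeasure, integral_withDensity_eq_integral_toReal_smul measurable_w.ennreal_ofReal
    (.of_forall fun _ => ENNReal.ofReal_lt_top)]
  simp only [ENNReal.toReal_ofReal (w_nonneg _), smul_eq_mul, mul_comm]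

theorem IsGapSystem.isProbabilityMeasure (h : IsGapSystem α β) :
    IsProbabilityMeasure (weightMeasure α β) := by
  constructor
  rw [weightMeasure, withDensity_apply _ .univ, Measure.restrict_univ,
    ← ofReal_integral_eq_lintegral_ofReal h.integrableOn_w (.of_forall w_nonneg), h.integral_w,
    ENNReal.ofReal_one]

instance : NullSingletonClass (weightMeasure α β) :=
  nullSingletonClass_withDensity _

theorem ae_mem_Icc_weightMeasure : ∀ᵐ t ∂weightMeasure α β, t ∈ Icc (-1 : ℝ) 1 :=
  (withDensity_absolutelyContinuous _ _).ae_le <|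
    (ae_restrict_mem measurableSet_E).mono fun _ ht => E_subset_Icc ht

section Orthogonality

variable {a b : ℕ → ℝ}

theorem P_zero : P α β 0 = 1 := by
  rw [P]
  simp

theorem IsRecurrence.P_eq_firstKind (hr : IsRecurrence α β a b) (n : ℕ) :
    P α β n = firstKind a b n := by
  have hP : IsThreeTerm (fun n => X - C (b (n + 2))) (fun n => C (a (n + 1))) (P α β) := fun n => by
    have hrec := hr.2 (n + 1) n.succ_pos
    simp only [Nat.add_sub_cancel] at hrec
    linear_combination -hrec
  refine hP.ext (isThreeTerm_firstKind a b) (by rw [P_zero, firstKind]) ?_ n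
  have hrec := hr.1
  rw [P_zero] at hrec
  rw [firstKind]
  linear_combination -hrec

variable (α β) in
/-- The moment functional `p ↦ ∫_E p(x) w(x) dx`. -/
noncomputable abbrev weightFunctional [IsFiniteMeasure (weightMeasure α β)] : ℝ[X] →ₗ[ℝ] ℝ :=
  momentFunctional isCompact_Icc (ae_mem_Icc_weightMeasure (α := α) (β := β))

variable [IsProbabilityMeasure (weightMeasure α β)]

theorem ip_eq_weightFunctional (p q : ℝ[X]) : ip α β p q = weightFunctional α β (p * q) := by
  simp [ip, momentFunctional, integral_weightMeasure]

theorem IsRecurrence.weightFunctional_mul_eq_zero (hr : IsRecurrence α β a b) {m n : ℕ}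
    (hmn : m < n) : weightFunctional α β (P α β n * P α β m) = 0 := by
  induction n using Nat.strong_induction_on generalizing m with
  | _ n ih =>
    have hpos : 0 < weightFunctional α β (P α β m * P α β m) := by
      rw [← sq]
      exact momentFunctional_sq_pos _ _ (hr.P_eq_firstKind m ▸ (monic_firstKind a b m).ne_zero)
    have hne (k : Fin n) (hk : (k : ℕ) ≠ m) : weightFunctional α β (P α β k * P α β m) = 0 := by
      rcases hk.lt_or_gt with hlt | hlt
      · rw [mul_comm]
        exact ih m hmn hlt
      · exact ih k k.2 hlt
    rw [P, sub_mul, map_sub, Finset.sum_mul, map_sum, Finset.sum_eq_single (⟨m, hmn⟩ : Fin n)]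
    · rw [mul_assoc, linearMap_C_mul, ip_eq_weightFunctional, ip_eq_weightFunctional,
        div_mul_cancel₀ _ hpos.ne', sub_self]
    · intro k _ hk
      rw [mul_assoc, linearMap_C_mul, hne k (fun hkm => hk (Fin.ext hkm)), mul_zero]
    · simp

theorem IsRecurrence.isOrthogonalFunctional (hr : IsRecurrence α β a b) :
    IsOrthogonalFunctional a b (weightFunctional α β) where
  map_one := by simp [momentFunctional]
  map_mul_eq_zero {m n} hmn := by
    rw [← hr.P_eq_firstKind, ← hr.P_eq_firstKind]
    rcases hmn.lt_or_gt with hlt | hlt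
    · rw [mul_comm]
      exact hr.weightFunctional_mul_eq_zero hlt
    · exact hr.weightFunctional_mul_eq_zero hlt

theorem IsRecurrence.Q_eq_eval_secondKind (hr : IsRecurrence α β a b) (n : ℕ) (x : ℝ) :
    Q α β n x = (secondKind a b n).eval x := by
  rw [Q, ← integral_weightMeasure, ← hr.isOrthogonalFunctional.integral_diffQuot_firstKind,
    hr.P_eq_firstKind]

end Orthogonality

/-- The numerator of the square of the Stieltjes transform of the weight. -/
noncomputable def gapNum (α : Fin g → ℝ) : ℝ[X] := ∏ i, (X - C (α i))

/-- The denominator of the square of the Stieltjes transform of the weight. -/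
noncomputable def gapDen (β : Fin g → ℝ) : ℝ[X] := (X ^ 2 - 1) * ∏ i, (X - C (β i))

theorem isRoot_gapNum {x : ℝ} : (gapNum α).IsRoot x ↔ x ∈ range α := by
  simp [gapNum, IsRoot, eval_prod, Finset.prod_eq_zero_iff, sub_eq_zero, eq_comm (a := x)]

theorem isRoot_gapDen {x : ℝ} : (gapDen β).IsRoot x ↔ x ∈ ({-1, 1} ∪ range β : Set ℝ) := by
  simp [gapDen, IsRoot, eval_prod, Finset.prod_eq_zero_iff, sub_eq_zero, eq_comm (a := x), or_comm]

theorem monic_gapNum : (gapNum α).Monic := monic_prod_X_sub_C _ _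

theorem IsGapSystem.rootMultiplicity_gapNum (h : IsGapSystem α β) :
    rootMultiplicity 1 (gapNum α) = 0 := by
  refine rootMultiplicity_eq_zero fun hroot => ?_
  obtain ⟨i, hi⟩ := isRoot_gapNum.mp hroot
  obtain ⟨-, hαβ, hβ⟩ := h.1 i
  linarith

theorem IsGapSystem.rootMultiplicity_gapDen (h : IsGapSystem α β) :
    rootMultiplicity 1 (gapDen β) = 1 := by
  have hsplit : gapDen β = (X - C 1) * ((X + 1) * gapNum β) := by
    rw [gapDen, gapNum, C_1]
    ring
  have hne : ¬((X + 1) * gapNum β).IsRoot 1 := by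
    rw [root_mul, isRoot_gapNum, not_or]
    refine ⟨by simp [IsRoot], ?_⟩
    rintro ⟨i, hi⟩
    exact (h.1 i).2.2.ne hi
  have hne0 : (X + 1) * gapNum β ≠ 0 := fun h0 => hne (by simp [h0])
  rw [hsplit, rootMultiplicity_mul (mul_ne_zero (X_sub_C_ne_zero 1) hne0),
    rootMultiplicity_X_sub_C_self, rootMultiplicity_eq_zero hne]

theorem IsGapSystem.stieltjes_sq_mul_gapDen (h : IsGapSystem α β) {x : ℝ} (hx : 1 < x) :
    (∫ t, 1 / (x - t) ∂weightMeasure α β) ^ 2 * (gapDen β).eval x = (gapNum α).eval x := by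
  have hx2 : 0 < x ^ 2 - 1 := by nlinarith
  have hratio : 0 < ∏ i, (x - α i) / (x - β i) := h.prod_ratio_pos fun hmem => hx.not_ge hmem.2
  have hden : ∏ i, (x - β i) ≠ 0 :=
    Finset.prod_ne_zero_iff.mpr fun i _ => (sub_pos.mpr ((h.1 i).2.2.trans hx)).ne'
  have hsq := congrArg (· ^ 2) (h.integral_w_div_sub hx)
  simp only [mul_pow, Real.sq_sqrt hx2.le, Real.sq_sqrt hratio.le] at hsq
  rw [Finset.prod_div_distrib, eq_div_iff hden] at hsq
  simp only [integral_weightMeasure, one_div_mul_eq_div, gapNum, gapDen, eval_mul, eval_sub,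
    eval_pow, eval_X, eval_one, eval_prod, eval_C]
  linear_combination hsq

theorem IsGapSystem.isPeriod (h : IsGapSystem α β) {a b : ℕ → ℝ} (hr : IsRecurrence α β a b)
    {M : ℕ} (hM : 0 < M) (hb : ∀ n, 1 ≤ n → b (n + M) = b n)
    (ha : ∀ n, 2 ≤ n → a (n + M) = a n) :
    IsPeriod a b M ∧ periodPoly a b M * gapNum α = secondKind a b M * gapDen β := by
  have := h.isProbabilityMeasure
  refine hr.isOrthogonalFunctional.isPeriod monic_gapNum.ne_zero (x₀ := 1) ?_ ?_ (Ioi_infinite 1)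
    (disjoint_left.mpr fun x hx hmem => hmem.2.not_gt hx) (fun x hx => h.stieltjes_sq_mul_gapDen hx)
    hM hb ha
  · simp [h.rootMultiplicity_gapNum]
  · simp [h.rootMultiplicity_gapDen]

end Weight

section Wronskian

namespace IsThreeTerm

variable {a b : ℕ → ℝ} {y : ℕ → ℝ[X]} {x : ℝ}

theorem eval_wronskian_succ (hy : IsThreeTerm (fun n => X - C (b n)) (fun n => C (a n)) y) (n : ℕ)
    (x : ℝ) : (wronskian (y (n + 1)) (y (n + 2))).eval x =
      (y (n + 1)).eval x ^ 2 + a n * (wronskian (y n) (y (n + 1))).eval x := by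
  rw [hy.wronskian_succ, eval_add, eval_pow, eval_mul, eval_C]

theorem eval_wronskian_pos (hy : IsThreeTerm (fun n => X - C (b n)) (fun n => C (a n)) y)
    (ha : ∀ n, 0 < a n) (h0 : 0 < (wronskian (y 0) (y 1)).eval x) (n : ℕ) :
    0 < (wronskian (y n) (y (n + 1))).eval x := by
  induction n with
  | zero => exact h0
  | succ n ih =>
    rw [hy.eval_wronskian_succ]
    have := ha n
    positivity

theorem sq_eval_le_eval_wronskian (hy : IsThreeTerm (fun n => X - C (b n)) (fun n => C (a n)) y)
    (ha : ∀ n, 0 ≤ a n) (h0 : (y 0).eval x ^ 2 ≤ (wronskian (y 0) (y 1)).eval x) (n : ℕ) :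
    (y n).eval x ^ 2 ≤ (wronskian (y n) (y (n + 1))).eval x := by
  induction n with
  | zero => exact h0
  | succ n ih =>
    rw [hy.eval_wronskian_succ]
    exact le_add_of_nonneg_right (mul_nonneg (ha n) ((sq_nonneg _).trans ih))

theorem eval_wronskian_neg_of_succ
    (hy : IsThreeTerm (fun n => X - C (b n)) (fun n => C (a n)) y) {n : ℕ} (ha : 0 ≤ a n)
    (h : (wronskian (y (n + 1)) (y (n + 2))).eval x < (y (n + 1)).eval x ^ 2) :
    (wronskian (y n) (y (n + 1))).eval x < 0 := by
  rw [hy.eval_wronskian_succ, add_lt_iff_neg_left] at h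
  exact neg_of_mul_neg_right h ha

end IsThreeTerm

/-- The Wronskian form of `y r / V = 1 / (y' / y - r' / r)` being decreasing. -/
theorem eval_wronskian_mul_neg {y y' r r' V : ℝ[X]} {c x : ℝ} (hc : 0 < c)
    (hV : y' * r - y * r' = C c * V) (hVx : V.eval x ≠ 0) (hy : 0 < (wronskian y y').eval x)
    (hr : (wronskian r r').eval x < 0) : (wronskian V (y * r)).eval x < 0 := by
  have hid : C c * wronskian V (y * r) = y ^ 2 * wronskian r r' - r ^ 2 * wronskian y y' := by
    have hV' := congrArg derivative hV
    simp only [derivative_mul, derivative_sub, derivative_C, zero_mul, zero_add] at hV'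
    simp only [wronskian, derivative_mul]
    linear_combination (y * r) * hV' - (derivative y * r + y * derivative r) * hV
  have hne : y.eval x ≠ 0 ∨ r.eval x ≠ 0 := by
    by_contra! h
    have hVx0 := congrArg (eval x) hV
    simp only [eval_sub, eval_mul, eval_C, h.1, h.2, mul_zero, zero_mul, sub_zero] at hVx0
    exact mul_ne_zero hc.ne' hVx hVx0.symm
  have hidx := congrArg (eval x) hid
  simp only [eval_sub, eval_mul, eval_C, eval_pow] at hidx
  refine neg_of_mul_neg_right (hidx.trans_lt ?_) hc.le
  rcases hne with h | h
  · nlinarith [mul_pos (sq_pos_of_ne_zero h) (neg_pos.mpr hr),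
      mul_nonneg (sq_nonneg (r.eval x)) hy.le]
  · nlinarith [mul_pos (sq_pos_of_ne_zero h) hy,
      mul_nonneg (sq_nonneg (y.eval x)) (neg_pos.mpr hr).le]

variable {a b : ℕ → ℝ}

theorem eval_wronskian_firstKind_pos (ha : ∀ n, 0 < a (n + 1)) (n : ℕ) (x : ℝ) :
    0 < (wronskian (firstKind a b n) (firstKind a b (n + 1))).eval x :=
  (isThreeTerm_firstKind a b).eval_wronskian_pos ha (by simp [firstKind, wronskian]) n

theorem eval_wronskian_secondKind_pos (ha : ∀ n, 0 < a (n + 1)) (n : ℕ) (x : ℝ) :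
    0 < (wronskian (secondKind a b (n + 1)) (secondKind a b (n + 2))).eval x :=
  eval_wronskian_firstKind_pos (fun n => ha (n + 1)) n x

/-- The solution of the recurrence with constant initial values that vanishes at `x` at the index
`n + 1` has a positive Christoffel–Darboux kernel. -/
theorem eval_wronskian_secondKind_firstKind_pos (ha : ∀ n, 0 < a (n + 1)) (n : ℕ) (x : ℝ) :
    0 < (wronskian (secondKind a b (n + 1)) (firstKind a b (n + 1))).eval x := by
  set p := (firstKind a b (n + 1)).eval x with hp
  set q := (secondKind a b (n + 1)).eval x with hq
  set y : ℕ → ℝ[X] := fun k => C q * firstKind a b k - C p * secondKind a b k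
  have hy : IsThreeTerm (fun n => X - C (b (n + 2))) (fun n => C (a (n + 1))) y :=
    ((isThreeTerm_firstKind a b).mul_left _).sub ((isThreeTerm_secondKind a b).mul_left _)
  have hsq := hy.sq_eval_le_eval_wronskian (x := x) (fun k => (ha k).le)
    (by simp [y, firstKind, secondKind, wronskian, sq]) n
  set c := ∏ i ∈ Finset.range n, a (i + 1)
  have hc : 0 < c := Finset.prod_pos fun i _ => ha i
  have hyn : (y n).eval x = c := by
    have hcas := congrArg (eval x) (casoratian_firstKind_secondKind a b n)
    simp only [eval_sub, eval_mul, eval_C] at hcas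
    simp only [y, eval_sub, eval_mul, eval_C]
    linear_combination hcas
  have hwron : (wronskian (y n) (y (n + 1))).eval x =
      c * (wronskian (secondKind a b (n + 1)) (firstKind a b (n + 1))).eval x := by
    simp only [wronskian, eval_sub, eval_mul, hyn]
    simp only [y, derivative_sub, derivative_mul, derivative_C, eval_sub, eval_mul, eval_add,
      eval_C, ← hp, ← hq, eval_zero]
    ring
  rw [hyn, hwron] at hsq
  exact pos_of_mul_pos_right ((pow_pos hc 2).trans_le hsq) hc.le

end Wronskian

namespace IsPeriod

variable {a b : ℕ → ℝ} {M : ℕ}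

theorem two_mul_firstKind_add (h : IsPeriod a b M) {j : ℕ} (hj : 1 ≤ j) :
    2 * firstKind a b (M + j) =
      firstKind a b M * firstKind a b j + periodPoly a b M * secondKind a b j := by
  obtain ⟨j, rfl⟩ : ∃ k, j = k + 1 := ⟨j - 1, by omega⟩
  have hleft : IsThreeTerm (fun n => X - C (b (n + 1 + 2))) (fun n => C (a (n + 1 + 1)))
      fun n => 2 * firstKind a b (n + (M + 1)) := fun n => by
    have hrec := ((isThreeTerm_firstKind a b).mul_left 2).shift (M + 1) n
    have hbn : b (n + (M + 1) + 2) = b (n + 1 + 2) := by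
      rw [← h.coeff_b (n := n + 1 + 2) (by omega)]
      congr 1
      omega
    have han : a (n + (M + 1) + 1) = a (n + 1 + 1) := by
      rw [← h.coeff_a (n := n + 1 + 1) (by omega)]
      congr 1
      omega
    simpa only [han, hbn] using hrec
  have hright := ((isThreeTerm_firstKind a b).shift 1).mul_left (firstKind a b M) |>.add
    (((isThreeTerm_secondKind a b).shift 1).mul_left (periodPoly a b M))
  have heq := hleft.ext hright ?_ ?_ j
  · rwa [show M + (j + 1) = j + (M + 1) by ring]
  · simp only [periodPoly, firstKind, secondKind, zero_add]
    ring
  · have hrec := isThreeTerm_firstKind a b M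
    have hb : b (M + 2) = b 2 := by rw [add_comm, h.coeff_b one_le_two]
    have ha : C (a 1) = 2 * C (a (M + 1)) := by rw [h.coeff_one, C_mul, C_ofNat]
    simp only [hb] at hrec
    simp only [periodPoly, firstKind, secondKind, zero_add, Nat.reduceAdd]
    rw [show 1 + (M + 1) = M + 2 by ring, hrec, ha]
    ring

theorem eval_wronskian_firstKind_periodPoly_pos (h : IsPeriod a b M) (x : ℝ) :
    0 < (wronskian (firstKind a b M) (periodPoly a b M)).eval x := by
  have hpos := eval_wronskian_firstKind_pos (b := b) h.coeff_pos M x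
  have hsq := (isThreeTerm_firstKind a b).sq_eval_le_eval_wronskian (x := x)
    (fun n => (h.coeff_pos n).le) (by simp [firstKind, wronskian]) M
  have hid : wronskian (firstKind a b M) (periodPoly a b M) =
      2 * wronskian (firstKind a b M) (firstKind a b (M + 1)) - firstKind a b M ^ 2 := by
    have h2 : derivative (2 : ℝ[X]) = 0 := derivative_ofNat 2
    simp only [wronskian, periodPoly, firstKind, derivative_sub, derivative_mul, derivative_X,
      derivative_C, h2]
    ring
  rw [hid, eval_sub, eval_mul, eval_pow, eval_ofNat]
  linarith

end IsPeriod

section Reflected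

variable (a b : ℕ → ℝ) (M : ℕ)

/-- The solution `r_n = P_n P_M - Q_n G` of the recurrence. For a period `M` the polynomial `r_M` is
constant and `2 r_{M+1} = P_1 r_M`, so that `r_n` is determined by running the recurrence backwards
from `n = M`. -/
noncomputable def reflected (n : ℕ) : ℝ[X] :=
  firstKind a b n * firstKind a b M - secondKind a b n * periodPoly a b M

theorem isThreeTerm_reflected :
    IsThreeTerm (fun n => X - C (b (n + 2))) (fun n => C (a (n + 1))) (reflected a b M) := by
  unfold reflected
  simpa only [mul_comm] using ((isThreeTerm_firstKind a b).mul_left (firstKind a b M)).sub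
    ((isThreeTerm_secondKind a b).mul_left (periodPoly a b M))

theorem casoratian_firstKind_reflected (n : ℕ) :
    firstKind a b (n + 1) * reflected a b M n - firstKind a b n * reflected a b M (n + 1) =
      C (∏ i ∈ Finset.range n, a (i + 1)) * periodPoly a b M := by
  simp only [reflected]
  linear_combination periodPoly a b M * casoratian_firstKind_secondKind a b n

theorem casoratian_secondKind_reflected (n : ℕ) :
    secondKind a b (n + 1) * reflected a b M n - secondKind a b n * reflected a b M (n + 1) =
      C (∏ i ∈ Finset.range n, a (i + 1)) * firstKind a b M := by
  simp only [reflected]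
  linear_combination firstKind a b M * casoratian_firstKind_secondKind a b n

end Reflected

namespace IsPeriod

variable {a b : ℕ → ℝ} {M : ℕ}

theorem reflected_self (h : IsPeriod a b M) :
    reflected a b M M = C (2 * ∏ i ∈ Finset.range M, a (i + 1)) := by
  rw [C_mul, C_ofNat, reflected, periodPoly]
  linear_combination 2 * casoratian_firstKind_secondKind a b M -
    firstKind a b M * h.two_mul_secondKind

theorem two_mul_reflected_succ_self (h : IsPeriod a b M) :
    2 * reflected a b M (M + 1) = firstKind a b 1 * reflected a b M M := by
  rw [reflected, reflected, periodPoly]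
  linear_combination (firstKind a b 1 * firstKind a b M - 2 * firstKind a b (M + 1)) *
    h.two_mul_secondKind

theorem eval_wronskian_reflected_self_lt (h : IsPeriod a b M) (x : ℝ) :
    (wronskian (reflected a b M M) (reflected a b M (M + 1))).eval x <
      (reflected a b M M).eval x ^ 2 := by
  have hpos : 0 < 2 * ∏ i ∈ Finset.range M, a (i + 1) :=
    mul_pos two_pos (Finset.prod_pos fun i _ => h.coeff_pos i)
  have hsucc := congrArg derivative h.two_mul_reflected_succ_self
  rw [h.reflected_self] at hsucc ⊢
  simp only [firstKind, derivative_mul, derivative_sub, derivative_X, derivative_C,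
    derivative_ofNat] at hsucc
  have hd := congrArg (eval x) hsucc
  simp only [eval_add, eval_sub, eval_mul, eval_C, eval_X, eval_ofNat, eval_zero, eval_one] at hd
  simp only [wronskian, derivative_C, eval_sub, eval_mul, eval_C, eval_zero]
  nlinarith [sq_pos_of_pos hpos]

theorem eval_wronskian_reflected_neg (h : IsPeriod a b M) {n : ℕ} (hn : n < M) (x : ℝ) :
    (wronskian (reflected a b M n) (reflected a b M (n + 1))).eval x < 0 := by
  have hstep {k : ℕ} := (isThreeTerm_reflected a b M).eval_wronskian_neg_of_succ (x := x)
    (h.coeff_pos k).le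
  refine hstep (Nat.decreasingInduction' (P := fun k =>
    (wronskian (reflected a b M k) (reflected a b M (k + 1))).eval x <
      (reflected a b M k).eval x ^ 2) (fun k _ _ hk => ?_) (Nat.succ_le_of_lt hn)
    (h.eval_wronskian_reflected_self_lt x))
  exact (hstep hk).trans_le (sq_nonneg _)

end IsPeriod

section Sturm

theorem strictMonoOn_eval_div {f g : ℝ[X]} {s : Set ℝ} (hs : Convex ℝ s)
    (hg : ∀ x ∈ s, g.eval x ≠ 0) (h : ∀ x ∈ interior s, 0 < (wronskian g f).eval x) :
    StrictMonoOn (fun x => f.eval x / g.eval x) s := by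
  refine strictMonoOn_of_deriv_pos hs (f.continuousOn.div g.continuousOn hg) fun x hx => ?_
  have hgx := hg x (interior_subset hx)
  have hwron := h x hx
  rw [((f.hasDerivAt x).fun_div (g.hasDerivAt x) hgx).deriv]
  simp only [wronskian, eval_sub, eval_mul] at hwron
  exact div_pos (by linarith) (by positivity)

theorem eval_mul_eval_pos {f g : ℝ[X]} {p c : ℝ} (hpc : p < c)
    (hg : ∀ x ∈ Icc p c, g.eval x ≠ 0) (h : ∀ x ∈ Ioo p c, 0 < (wronskian g f).eval x)
    (hf : f.eval p = 0) : 0 < f.eval c * g.eval c := by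
  have hlt := strictMonoOn_eval_div (convex_Icc p c) hg (by rwa [interior_Icc])
    (left_mem_Icc.mpr hpc.le) (right_mem_Icc.mpr hpc.le) hpc
  simp only [hf, zero_div] at hlt
  rcases div_pos_iff.mp hlt with ⟨hfc, hgc⟩ | ⟨hfc, hgc⟩
  · exact mul_pos hfc hgc
  · exact mul_pos_of_neg_of_neg hfc hgc

theorem eventually_sign_eval_mul_eval {f g : ℝ[X]} {x : ℝ} (h : 0 < (wronskian f g).eval x)
    (hg : g.eval x = 0) :
    ∀ᶠ t in 𝓝 x, SignType.sign (f.eval t * g.eval t) = SignType.sign (t - x) := by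
  have hderiv : 0 < deriv (fun t => f.eval t * g.eval t) x := by
    simp_rw [← eval_mul]
    rw [Polynomial.deriv, derivative_mul, eval_add, eval_mul, eval_mul, hg]
    simpa [wronskian, hg] using h
  exact eventually_nhdsWithin_sign_eq_of_deriv_pos hderiv (by simp [hg])

theorem eventually_nhdsGT_eval_mul_eval_pos {f g : ℝ[X]} {x : ℝ}
    (h : 0 < (wronskian f g).eval x) (hg : g.eval x = 0) :
    ∀ᶠ t in 𝓝[>] x, 0 < f.eval t * g.eval t := by
  filter_upwards [(eventually_sign_eval_mul_eval h hg).filter_mono nhdsWithin_le_nhds,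
    self_mem_nhdsWithin] with t ht htx
  rwa [sign_pos (sub_pos.mpr htx), sign_eq_one_iff] at ht

theorem eventually_nhdsLT_eval_mul_eval_neg {f g : ℝ[X]} {x : ℝ}
    (h : 0 < (wronskian f g).eval x) (hg : g.eval x = 0) :
    ∀ᶠ t in 𝓝[<] x, f.eval t * g.eval t < 0 := by
  filter_upwards [(eventually_sign_eval_mul_eval h hg).filter_mono nhdsWithin_le_nhds,
    self_mem_nhdsWithin] with t ht htx
  rwa [sign_neg (sub_neg.mpr htx), sign_eq_neg_one_iff] at ht

theorem wronskian_mul_mul (d f g : ℝ[X]) : wronskian (d * f) (d * g) = d ^ 2 * wronskian f g := by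
  simp only [wronskian, derivative_mul]
  ring

theorem eval_mul_eval_neg_of_common_factor {d f g : ℝ[X]} {p c : ℝ} (hpc : p < c)
    (hf : f.eval p = 0) (hgp : g.eval p ≠ 0) (hg : ∀ x ∈ Ioc p c, (d * g).eval x ≠ 0)
    (h : ∀ x ∈ Ioc p c, (wronskian (d * g) (d * f)).eval x < 0) :
    (d * f).eval c * (d * g).eval c < 0 := by
  simp only [eval_mul, mul_ne_zero_iff] at hg
  have hfg : 0 < (-f).eval c * g.eval c := by
    refine eval_mul_eval_pos hpc (fun x hx => ?_) (fun x hx => ?_) (by simp [hf])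
    · rcases hx.1.eq_or_lt with rfl | hpx
      exacts [hgp, (hg x ⟨hpx, hx.2⟩).2]
    · have hneg := h x (Ioo_subset_Ioc_self hx)
      rw [wronskian_mul_mul, eval_mul, eval_pow] at hneg
      rw [wronskian_neg_right, eval_neg]
      exact neg_pos.mpr (neg_of_mul_neg_right hneg (sq_nonneg _))
  have hd := sq_pos_of_ne_zero (hg c (right_mem_Ioc.mpr hpc)).1
  rw [eval_neg] at hfg
  simp only [eval_mul]
  nlinarith [mul_pos hd hfg]

variable {u v U V : ℝ[X]} {p c : ℝ}

theorem eval_mul_eval_neg_of_wronskian_neg (hUV : 0 < (wronskian U V).eval p)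
    (hS : ∀ x, V.eval x ≠ 0 → (wronskian V (u * (u * U - v * V))).eval x < 0) (hpc : p < c)
    (hu : u.eval p = 0) (hV : ∀ x ∈ Ioc p c, V.eval x ≠ 0) :
    (u * (u * U - v * V)).eval c * V.eval c < 0 := by
  by_cases hVp : V.eval p = 0
  · obtain ⟨u₁, rfl⟩ := dvd_iff_isRoot.mpr hu
    obtain ⟨V₁, rfl⟩ := dvd_iff_isRoot.mpr hVp
    have hV₁ : V₁.eval p ≠ 0 := fun h => hUV.ne' (by simp [wronskian, h])
    have hfactor : (X - C p) * u₁ * ((X - C p) * u₁ * U - v * ((X - C p) * V₁)) =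
      (X - C p) * (u₁ * ((X - C p) * u₁ * U - v * ((X - C p) * V₁))) := by ring
    rw [hfactor] at hS ⊢
    exact eval_mul_eval_neg_of_common_factor hpc (by simp) hV₁ hV fun x hx => hS x (hV x hx)
  · have := eval_mul_eval_neg_of_common_factor (d := 1) (f := u * (u * U - v * V)) (g := V) hpc
      (by simp [hu]) hVp
    simp only [one_mul] at this
    exact this hV fun x hx => hS x (hV x hx)

theorem eventually_nhdsGT_eval_pos (hvu : 0 < (wronskian v u).eval p)
    (hUV : 0 < (wronskian U V).eval p) (hu : u.eval p = 0) :
    ∀ᶠ x in 𝓝[>] p, 0 < (U * u + V * v).eval x * (V.eval x * v.eval x) := by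
  by_cases hVp : V.eval p = 0
  · filter_upwards [eventually_nhdsGT_eval_mul_eval_pos hvu hu,
      eventually_nhdsGT_eval_mul_eval_pos hUV hVp] with x hvux hUVx
    simp only [eval_add, eval_mul]
    nlinarith [mul_pos hvux hUVx, sq_nonneg (V.eval x * v.eval x)]
  · have hvp : v.eval p ≠ 0 := fun h => hvu.ne' (by simp [wronskian, hu, h])
    have hpos : 0 < ((U * u + V * v) * (V * v)).eval p := by
      simp only [eval_add, eval_mul, hu]
      have : 0 < (V.eval p * v.eval p) ^ 2 := by positivity
      linarith
    have := (Polynomial.continuous _).continuousAt.eventually (lt_mem_nhds hpos)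
    simpa only [eval_mul] using this.filter_mono nhdsWithin_le_nhds

theorem eventually_nhdsLT_eval_neg (hvu : ∀ᶠ x in 𝓝[<] c, 0 < v.eval x * u.eval x)
    (hUV : ∀ᶠ x in 𝓝[<] c, U.eval x * V.eval x < 0) (hu : u.eval c ≠ 0) (hU : U.eval c ≠ 0)
    (hc : v.eval c = 0 ∨ V.eval c = 0) :
    ∀ᶠ x in 𝓝[<] c, (U * u + V * v).eval x * (V.eval x * v.eval x) < 0 := by
  have hpos : 0 < ((U * u + V * v) * (U * u)).eval c := by
    have hVv : V.eval c * v.eval c = 0 := by rcases hc with h | h <;> simp [h]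
    simp only [eval_add, eval_mul, hVv, add_zero, ← sq]
    positivity
  have := (Polynomial.continuous _).continuousAt.eventually (lt_mem_nhds hpos)
  filter_upwards [hvu, hUV, this.filter_mono nhdsWithin_le_nhds] with x hvux hUVx hx
  have hneg := mul_neg_of_pos_of_neg hx (mul_neg_of_neg_of_pos hUVx hvux)
  refine neg_of_mul_neg_left (b := (U.eval x * u.eval x) ^ 2) ?_ (sq_nonneg _)
  simp only [eval_mul] at hneg
  linarith

theorem eval_ne_zero_and_eventually_nhdsLT_neg (hUV : ∀ x, 0 < (wronskian U V).eval x)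
    (hS : ∀ x, V.eval x ≠ 0 → (wronskian V (u * (u * U - v * V))).eval x < 0) (hpc : p < c)
    (hu : u.eval p = 0) (hV : ∀ x ∈ Ioo p c, V.eval x ≠ 0) (hc : v.eval c = 0 ∨ V.eval c = 0) :
    U.eval c ≠ 0 ∧ ∀ᶠ x in 𝓝[<] c, U.eval x * V.eval x < 0 := by
  by_cases hVc : V.eval c = 0
  · exact ⟨fun h => (hUV c).ne' (by simp [wronskian, hVc, h]),
      eventually_nhdsLT_eval_mul_eval_neg (hUV c) hVc⟩
  have hneg := eval_mul_eval_neg_of_wronskian_neg (hUV p) hS hpc hu fun x hx =>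
    hx.2.eq_or_lt.elim (fun h => h ▸ hVc) fun h => hV x ⟨hx.1, h⟩
  simp only [eval_mul, eval_sub, hc.resolve_right hVc, zero_mul, sub_zero] at hneg
  have hUVc : (U * V).eval c < 0 := by
    rw [eval_mul]
    exact neg_of_mul_neg_right (by linarith) (sq_nonneg (u.eval c))
  refine ⟨left_ne_zero_of_mul (b := V.eval c) (eval_mul (p := U) (q := V) ▸ hUVc.ne), ?_⟩
  simpa only [eval_mul] using ((Polynomial.continuous _).continuousAt.eventually
    (gt_mem_nhds hUVc)).filter_mono nhdsWithin_le_nhds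

theorem eval_mul_eval_pos_of_wronskian_pos (hvu : ∀ x, 0 < (wronskian v u).eval x) (hpc : p < c)
    (hu : u.eval p = 0) (hv : ∀ x ∈ Ioc p c, v.eval x ≠ 0) : 0 < u.eval c * v.eval c := by
  refine eval_mul_eval_pos hpc (fun x hx => ?_) (fun x _ => hvu x) hu
  rcases hx.1.eq_or_lt with rfl | hpx
  · exact fun h => (hvu p).ne' (by simp [wronskian, hu, h])
  · exact hv x ⟨hpx, hx.2⟩

theorem exists_zero_of_ne_zero_between (hvu : ∀ x, 0 < (wronskian v u).eval x)
    (hUV : ∀ x, 0 < (wronskian U V).eval x)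
    (hS : ∀ x, V.eval x ≠ 0 → (wronskian V (u * (u * U - v * V))).eval x < 0) (hpc : p < c)
    (hu : u.eval p = 0) (hne : ∀ x ∈ Ioo p c, v.eval x ≠ 0 ∧ V.eval x ≠ 0)
    (hc : v.eval c = 0 ∨ V.eval c = 0) :
    ∃ z ∈ Ioo p c, (U * u + V * v).eval z = 0 := by
  have hvu_pos (x : ℝ) (hx : x ∈ Ioc p c) (hvx : v.eval x ≠ 0) : 0 < u.eval x * v.eval x :=
    eval_mul_eval_pos_of_wronskian_pos hvu hx.1 hu fun t ht =>
      ht.2.eq_or_lt.elim (fun h => h ▸ hvx) fun h => (hne t ⟨ht.1, h.trans_le hx.2⟩).1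
  have huc : u.eval c ≠ 0 := fun h => by
    by_cases hvc : v.eval c = 0
    · exact (hvu c).ne' (by simp [wronskian, h, hvc])
    · exact (hvu_pos c ⟨hpc, le_rfl⟩ hvc).ne' (by simp [h])
  obtain ⟨hUc, hUVc⟩ := eval_ne_zero_and_eventually_nhdsLT_neg hUV hS hpc hu
    (fun x hx => (hne x hx).2) hc
  have hIoo : Ioo p c ∈ 𝓝[<] c := Ioo_mem_nhdsLT hpc
  have hright := eventually_nhdsLT_eval_neg (c := c) (by
    filter_upwards [hIoo] with x hx
    rw [mul_comm]
    exact hvu_pos x (Ioo_subset_Ioc_self hx) (hne x hx).1) hUVc huc hUc hc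
  obtain ⟨x, hxpos, hx⟩ := ((eventually_nhdsGT_eval_pos (hvu p) (hUV p) hu).and
    (Ioo_mem_nhdsGT hpc)).exists
  obtain ⟨y, hyneg, hy⟩ := (hright.and hIoo).exists
  obtain ⟨z, hz, hz0⟩ := isPreconnected_Ioo.intermediate_value hy hx
    (f := fun t => (U * u + V * v).eval t * (V.eval t * v.eval t))
    (by fun_prop) ⟨hyneg.le, hxpos.le⟩
  exact ⟨z, hz, (mul_eq_zero.mp hz0).resolve_right
    (mul_ne_zero (hne z hz).2 (hne z hz).1)⟩

theorem exists_zero_mem_Ioo (hvu : ∀ x, 0 < (wronskian v u).eval x)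
    (hUV : ∀ x, 0 < (wronskian U V).eval x)
    (hS : ∀ x, V.eval x ≠ 0 → (wronskian V (u * (u * U - v * V))).eval x < 0) (hpc : p < c)
    (hu : u.eval p = 0) (hc : v.eval c = 0 ∨ V.eval c = 0) :
    ∃ z ∈ Ioo p c, (U * u + V * v).eval z = 0 := by
  have hvV : v * V ≠ 0 := by
    refine mul_ne_zero ?_ ?_ <;> rintro rfl
    exacts [(hvu 0).ne' (by simp), (hUV 0).ne' (by simp)]
  obtain ⟨d, ⟨hd, hdc⟩, hmin⟩ := exists_min_image ({x | (v * V).IsRoot x} ∩ Ioc p c) id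
    ((finite_setOfPred_isRoot hvV).inter_of_left _) ⟨c, by simpa using hc, hpc, le_rfl⟩
  have hne (x : ℝ) (hx : x ∈ Ioo p d) : v.eval x ≠ 0 ∧ V.eval x ≠ 0 := by
    by_contra! h
    refine hx.2.not_ge (hmin x ⟨?_, hx.1, hx.2.le.trans hdc.2⟩)
    rw [mem_ofPred_eq, IsRoot.def, eval_mul, mul_eq_zero]
    exact or_iff_not_imp_left.mpr h
  obtain ⟨z, hz, hz0⟩ := exists_zero_of_ne_zero_between hvu hUV hS hdc.1 hu hne (by simpa using hd)
  exact ⟨z, ⟨hz.1, hz.2.trans_le hdc.2⟩, hz0⟩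

end Sturm

namespace IsPeriod

variable {a b : ℕ → ℝ} {M j : ℕ} {p c : ℝ}

theorem exists_zero_of_firstKind_zero (h : IsPeriod a b M) (hj : 1 ≤ j) (hjM : j < M) (hpc : p < c)
    (hp : (firstKind a b j).eval p = 0)
    (hc : (secondKind a b j).eval c = 0 ∨ (periodPoly a b M).eval c = 0) :
    ∃ z ∈ Ioo p c, (firstKind a b (M + j)).eval z = 0 := by
  have hS (x : ℝ) (hx : (periodPoly a b M).eval x ≠ 0) :
      (wronskian (periodPoly a b M) (firstKind a b j * (firstKind a b j * firstKind a b M -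
        secondKind a b j * periodPoly a b M))).eval x < 0 :=
    eval_wronskian_mul_neg (Finset.prod_pos fun i _ => h.coeff_pos i)
      (casoratian_firstKind_reflected a b M j) hx (eval_wronskian_firstKind_pos h.coeff_pos j x)
      (h.eval_wronskian_reflected_neg hjM x)
  obtain ⟨j, rfl⟩ : ∃ k, j = k + 1 := ⟨j - 1, by omega⟩
  obtain ⟨z, hz, hz0⟩ := exists_zero_mem_Ioo
    (eval_wronskian_secondKind_firstKind_pos h.coeff_pos j)
    h.eval_wronskian_firstKind_periodPoly_pos hS hpc hp hc
  refine ⟨z, hz, ?_⟩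
  rw [← h.two_mul_firstKind_add hj] at hz0
  simpa using hz0

theorem exists_zero_of_secondKind_zero (h : IsPeriod a b M) (hj : 1 ≤ j) (hjM : j < M)
    (hpc : p < c) (hp : (secondKind a b j).eval p = 0)
    (hc : (firstKind a b M).eval c = 0 ∨ (firstKind a b j).eval c = 0) :
    ∃ z ∈ Ioo p c, (firstKind a b (M + j)).eval z = 0 := by
  obtain ⟨k, rfl⟩ : ∃ k, j = k + 1 := ⟨j - 1, by omega⟩
  set u := secondKind a b (k + 1)
  set v := -firstKind a b (k + 1)
  set U := periodPoly a b M
  set V := -firstKind a b M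
  have hvu (x : ℝ) : 0 < (wronskian v u).eval x := by
    rw [wronskian_neg_left, wronskian_neg_eq]
    exact eval_wronskian_secondKind_firstKind_pos h.coeff_pos k x
  have hUV (x : ℝ) : 0 < (wronskian U V).eval x := by
    rw [wronskian_neg_right, wronskian_neg_eq]
    exact h.eval_wronskian_firstKind_periodPoly_pos x
  have hS (x : ℝ) (hx : V.eval x ≠ 0) : (wronskian V (u * (u * U - v * V))).eval x < 0 := by
    rw [eval_neg, neg_ne_zero] at hx
    have hneg := eval_wronskian_mul_neg (Finset.prod_pos fun i _ => h.coeff_pos i)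
      (casoratian_secondKind_reflected a b M (k + 1)) hx
      (eval_wronskian_secondKind_pos h.coeff_pos k x) (h.eval_wronskian_reflected_neg hjM x)
    have hr : u * (u * U - v * V) = -(u * reflected a b M (k + 1)) := by
      rw [reflected]
      ring
    rwa [hr, wronskian_neg_left, wronskian_neg_right, neg_neg]
  obtain ⟨z, hz, hz0⟩ := exists_zero_mem_Ioo hvu hUV hS hpc hp (by simpa [v, V] using hc.symm)
  refine ⟨z, hz, ?_⟩
  rw [neg_mul_neg, add_comm, ← h.two_mul_firstKind_add hj] at hz0
  simpa using hz0

end IsPeriod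

variable {g : ℕ} {α β : Fin g → ℝ}

theorem IsRecurrence.mem_zerosP_iff {a b : ℕ → ℝ} (hr : IsRecurrence α β a b) {n : ℕ} {x : ℝ} :
    x ∈ zerosP α β n ↔ (firstKind a b n).eval x = 0 := by
  rw [← hr.P_eq_firstKind]
  rfl

theorem IsGapSystem.mem_zerosQ_iff (h : IsGapSystem α β) {a b : ℕ → ℝ}
    (hr : IsRecurrence α β a b) {n : ℕ} {x : ℝ} :
    x ∈ zerosQ α β n ↔ (secondKind a b n).eval x = 0 := by
  have := h.isProbabilityMeasure
  rw [← hr.Q_eq_eval_secondKind]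
  rfl

theorem IsGapSystem.eval_eq_zero_of_mem_setB (h : IsGapSystem α β) {a b : ℕ → ℝ}
    (hr : IsRecurrence α β a b) {K n j : ℕ} {G : ℝ[X]}
    (hG : G * gapNum α = secondKind a b (n * K) * gapDen β) {x : ℝ} (hx : x ∈ setB α β K n j) :
    (secondKind a b j).eval x = 0 ∨ G.eval x = 0 := by
  obtain ⟨hx, hxα⟩ := hx
  have hGx := congrArg (eval x) hG
  simp only [eval_mul] at hGx
  have hG0 (h0 : (secondKind a b (n * K)).eval x * (gapDen β).eval x = 0) : G.eval x = 0 :=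
    (mul_eq_zero.mp (hGx.trans h0)).resolve_right (isRoot_gapNum.not.mpr hxα)
  rcases hx with (hx | hx) | hx
  · exact .inr (hG0 (mul_eq_zero_of_right _ (isRoot_gapDen.mpr hx)))
  · exact .inl ((h.mem_zerosQ_iff hr).mp hx)
  · exact .inr (hG0 (mul_eq_zero_of_left ((h.mem_zerosQ_iff hr).mp hx) _))

theorem IsGapSystem.exists_isPeriod (h : IsGapSystem α β) {K : ℕ} (hper : HasPeriod α β K) {n : ℕ}
    (hnK : 0 < n * K) : ∃ a b : ℕ → ℝ, IsRecurrence α β a b ∧ IsPeriod a b (n * K) ∧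
      periodPoly a b (n * K) * gapNum α = secondKind a b (n * K) * gapDen β := by
  obtain ⟨a, b, hr, hb, ha⟩ := hper
  have hiter {f : ℕ → ℝ} {k : ℕ} (hf : ∀ i, k ≤ i → f (i + K) = f i) (i : ℕ) (hi : k ≤ i) :
      f (i + n * K) = f i := by
    clear hnK
    induction n with
    | zero => simp
    | succ n ih => rw [add_mul, one_mul, ← add_assoc, hf _ (by omega), ih]
  exact ⟨a, b, hr, h.isPeriod hr hnK (hiter hb) (hiter ha)⟩

end GenChebyshev

theorem theorem4p3_general {g : ℕ} {α β : Fin g → ℝ} (hgap : GenChebyshev.IsGapSystem α β)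
    {K : ℕ} (hper : GenChebyshev.HasPeriod α β K) {n j : ℕ} (hj : 1 ≤ j) (hjK : j < n * K) :
    (∀ p ∈ GenChebyshev.zerosP α β j, ∀ b ∈ GenChebyshev.setB α β K n j, p < b →
      ∃ z ∈ GenChebyshev.zerosP α β (n * K + j), p < z ∧ z < b) ∧
    (∀ q ∈ GenChebyshev.zerosQ α β j, ∀ a ∈ GenChebyshev.setA α β K n j, q < a →
      ∃ z ∈ GenChebyshev.zerosP α β (n * K + j), q < z ∧ z < a) ∧
    (∀ p ∈ GenChebyshev.zerosP α β j, p ∈ GenChebyshev.setB α β K n j →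
      p ∈ GenChebyshev.zerosP α β (n * K + j)) := by
  obtain ⟨a, b, hr, hM, hG⟩ := hgap.exists_isPeriod hper (hj.trans_lt hjK).pos
  simp only [GenChebyshev.setA, mem_union, hr.mem_zerosP_iff, hgap.mem_zerosQ_iff hr]
  refine ⟨fun p hp c hc hpc => ?_, fun q hq c hc hqc => ?_, fun p hp hpB => ?_⟩
  · obtain ⟨z, hz, hz0⟩ := hM.exists_zero_of_firstKind_zero hj hjK hpc hp
      (hgap.eval_eq_zero_of_mem_setB hr hG hc)
    exact ⟨z, hz0, hz⟩
  · obtain ⟨z, hz, hz0⟩ := hM.exists_zero_of_secondKind_zero hj hjK hqc hq hc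
    exact ⟨z, hz0, hz⟩
  · have hadd := congrArg (eval p) (hM.two_mul_firstKind_add hj)
    rcases hgap.eval_eq_zero_of_mem_setB hr hG hpB with h | h <;> simpa [hp, h] using hadd

theorem theorem4p3 (g : ℕ) (α β : Fin g → ℝ) (hgap : GenChebyshev.IsGapSystem α β)
    (K : ℕ) (hper : GenChebyshev.HasPeriod α β K)
    (n j : ℕ) (hn : 1 ≤ n) (hj : 1 ≤ j) (hjK : j < K) :
    (∀ p ∈ GenChebyshev.zerosP α β j, ∀ b ∈ GenChebyshev.setB α β K n j, p < b →
      ∃ z ∈ GenChebyshev.zerosP α β (n * K + j), p < z ∧ z < b) ∧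
    (∀ q ∈ GenChebyshev.zerosQ α β j, ∀ a ∈ GenChebyshev.setA α β K n j, q < a →
      ∃ z ∈ GenChebyshev.zerosP α β (n * K + j), q < z ∧ z < a) ∧
    (∀ p ∈ GenChebyshev.zerosP α β j, p ∈ GenChebyshev.setB α β K n j →
      p ∈ GenChebyshev.zerosP α β (n * K + j)) :=
  theorem4p3_general hgap hper hj (hjK.trans_le (Nat.le_mul_of_pos_left K hn))
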